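/- Let $m=2^{\lambda_0}m_0\ge 1$ with $m_0$ odd, put $\lambda=\lambda_0+2$, so that $4m=2^\lambda m_0$, and let $D_{8m}=\langle x,y\mid x^{4m}=1,\ y^2=1,\ yxy=x^{-1}\rangle$. A binary left $D_{8m}$-code is a left ideal of the group algebra $\mathbb F_2[D_{8m}]$. Write $x^{m_0}-1=\prod_{i=0}^{\rho+2\epsilon}f_i(x)$ with pairwise coprime irreducible $f_i\in\mathbb F_2[x]$ of degree $d_i$, where $f_0=x+1$, $f_i$ is self-reciprocal with $d_i\ge2$ for $1\le i\le\rho$, and, for $\rho<i\le\rho+\epsilon$, $f_i$ is not self-reciprocal and its reciprocal polynomial is $f_i^*=f_{i+\epsilon}$. Put $r=\rho+2\epsilon$, $\mathcal A=\mathbb F_2[x]/\langle x^{4m}-1\rangle$, $A_i=\mathbb F_2[x]/\langle f_i^{2^\lambda}\rangle$, $F_i=(x^{m_0}-1)/f_i$; choose $u_i,v_i\in\mathbb F_2[x]$ with $u_iF_i+v_if_i=1$ and put $\varepsilon_i=u_i(x^{2^\lambda})F_i(x^{2^\lambda})\in\mathcal A$. Let $\varphi_i:A_i\to\mathcal A$,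 $a\mapsto\varepsilon_i a$, and for a linear code $C_i$ of length $2$ over $A_i$ (an $A_i$-submodule of $A_i^2$) let $\mathcal A_i\Box_{\varphi_i}C_i=\{(\varphi_i(\xi_0),\varphi_i(\xi_1))\mid(\xi_0,\xi_1)\in C_i\}=\varepsilon_iC_i\subseteq\mathcal A^2$. Identify $(\alpha,\beta)\in\mathcal A^2$ with $\alpha(x)+\beta(x)y\in\mathbb F_2[D_{8m}]$. In $\mathcal A$ and in every $A_i$, $x^{-1}$ means $x^{4m-1}$. Identify $A_i/\langle f_i^s\rangle$ with the set of polynomials of degree $<sd_i$ (it is $\{0\}$ for $s=0$), let $f_i(A_i/\langle f_i^s\rangle)$ be the subset of those divisible by $f_i$, and for $1\le s\le 2^\lambda$ let $\mathcal W_i^{(s)}$ be the set of $w\in A_i/\langle f_i^s\rangle$ with $w(x)w(x^{-1})\equiv1\pmod{f_i^s}$. A generator matrix of $C_i$ is a matrix whose rows span $C_i$, no row being a linear combination of the others (for $C_i=0$ redundant zero rows are allowed). Consider the following construction. (i) For each $0\le i\le\rho$, choose a linear code $C_i$ of length $2$ over $A_i$ with a generator matrix of one of the forms - I. $(1,a)$,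 $a\in\mathcal W_i^{(2^\lambda)}$; - II. $(f_i^k,f_i^ka)$, $1\le k\le 2^\lambda-1$, $a\in\mathcal W_i^{(2^\lambda-k)}$; - III. $f_i^kI_2$, $0\le k\le2^\lambda$; - IV. $\begin{pmatrix}1&c\\0&f_i^j\end{pmatrix}$, $1\le j\le2^\lambda-1$, $c\in\mathcal W_i^{(j)}$; - V. $\begin{pmatrix}f_i^k&f_i^kc\\0&f_i^{k+j}\end{pmatrix}$, $1\le k\le2^\lambda-2$, $1\le j\le2^\lambda-k-1$, $c\in\mathcal W_i^{(j)}$. (ii) For each $\rho<i\le\rho+\epsilon$, choose a linear code $C_i$ of length $2$ over $A_i$ with a generator matrix of one of the forms - 1. $(1,a)$, $a\in A_i$; - 2. $(f_i^k,f_i^ka)$, $1\le k\le2^\lambda-1$, $a\in A_i/\langle f_i^{2^\lambda-k}\rangle$; - 3. $(f_ib,1)$, $b\in A_i/\langle f_i^{2^\lambda-1}\rangle$; - 4. $(f_i^{k+1}b,f_i^k)$, $1\le k\le2^\lambda-1$, $b\in A_i/\langle f_i^{2^\lambda-k-1}\rangle$; - 5. $f_i^kI_2$, $0\le k\le2^\lambda$;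 - 6. $\begin{pmatrix}1&c\\0&f_i^j\end{pmatrix}$, $1\le j\le2^\lambda-1$, $c\in A_i/\langle f_i^j\rangle$; - 7. $\begin{pmatrix}f_i^k&f_i^kc\\0&f_i^{k+j}\end{pmatrix}$, $1\le k\le2^\lambda-2$, $1\le j\le2^\lambda-k-1$, $c\in A_i/\langle f_i^j\rangle$; - 8. $\begin{pmatrix}c&1\\f_i^j&0\end{pmatrix}$, $1\le j\le2^\lambda-1$, $c\in f_i(A_i/\langle f_i^j\rangle)$; - 9. $\begin{pmatrix}f_i^kc&f_i^k\\f_i^{k+j}&0\end{pmatrix}$, $1\le k\le2^\lambda-2$, $1\le j\le2^\lambda-k-1$, $c\in f_i(A_i/\langle f_i^j\rangle)$; and set $C_{i+\epsilon}=\{(b(x^{-1}),a(x^{-1}))\mid(a(x),b(x))\in C_i\}\subseteq A_{i+\epsilon}^2$. (iii) Set $\mathcal C=\sum_{i=0}^r\mathcal A_i\Box_{\varphi_i}C_i=\sum_{i=0}^r\varepsilon_iC_i$. Then the sum in (iii) is direct, every $\mathcal C$ so constructed is a binary left $D_{8m}$-code, and every binary left $D_{8m}$-code is obtained in this way from exactly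 one family $(C_i)_{0\le i\le r}$. Moreover $|\mathcal C|=\prod_{i=0}^r|C_i|$. Here, if $C_i$ has a generator matrix $G_i$ of one of the forms listed in (i) or (ii), then $|C_i|=\prod_{\alpha}2^{(2^\lambda-\|\alpha\|)d_i}$, the product being over the rows $\alpha$ of $G_i$, where $\|(a,b)\|=\min(\|a\|,\|b\|)$ and $\|a\|$ is the largest $j\le2^\lambda$ with $a\in f_i^jA_i$; and $|C_{i+\epsilon}|=|C_i|$ for $\rho<i\le\rho+\epsilon$. The number of all binary left $D_{8m}$-codes is $$\Bigl(\prod_{i=0}^{\rho}S_{(2,2^{d_i},2^\lambda)}\Bigr)\Bigl(\prod_{i=\rho+1}^{\rho+\epsilon}\mathcal L_{(2,2^{d_i},2^\lambda)}\Bigr),$$ where $S_{(2,2^{d_i},2^\lambda)}=1+2^\lambda+\sum_{j=1}^{2^\lambda}(2^\lambda-j+1)\,|\mathcal W_i^{(j)}|$ and $\mathcal L_{(2,2^{d_i},2^\lambda)}=\sum_{k=0}^{2^\lambda}(2k+1)2^{(2^\lambda-k)d_i}$. -/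

import Mathlib

open scoped Polynomial

/-- The group algebra `𝔽₂[D_{8m}]`; the generators of `D_{8m}` are `x = r 1` and `y = sr 0`.
A binary left `D_{8m}`-code is a left ideal of this ring, that is, a term of type
`Ideal (DihedralAlgebra m)`. -/
abbrev DihedralAlgebra (m : ℕ) : Type := MonoidAlgebra (ZMod 2) (DihedralGroup (4 * m))

/-- `𝒜 = 𝔽₂[x]/⟨x^{4m} - 1⟩`. -/
abbrev CyclicAlgebra (m : ℕ) : Type :=
  (ZMod 2)[X] ⧸ Ideal.span {(Polynomial.X ^ (4 * m) - 1 : (ZMod 2)[X])}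

/-- The notation attached to `m`: `m = 2^{λ₀} m₀` with `m₀` odd, the irreducible factors of
`x^{m₀} - 1` in a suitable order, and Bézout coefficients.  The index `i` with `0 ≤ i ≤ ρ` is
`Sum.inl i`; for `0 ≤ j < ε` the index `ρ + 1 + j` is `Sum.inr (Sum.inl j)` and the index
`ρ + ε + 1 + j` is `Sum.inr (Sum.inr j)`. -/
structure DihedralSetup (m : ℕ) where
  lam₀ : ℕ
  m₀ : ℕ
  m₀_odd : Odd m₀
  m_eq : m = 2 ^ lam₀ * m₀
  ρ : ℕ
  ε : ℕ
  f : Fin (ρ + 1) ⊕ (Fin ε ⊕ Fin ε) → (ZMod 2)[X]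
  f_irreducible : ∀ i, Irreducible (f i)
  f_coprime : Pairwise fun i j => IsCoprime (f i) (f j)
  f_prod : Polynomial.X ^ m₀ - 1 = ∏ i, f i
  f_zero : f (Sum.inl 0) = Polynomial.X + 1
  f_selfReciprocal : ∀ i, (f (Sum.inl i)).reverse = f (Sum.inl i)
  f_two_le : ∀ i, i ≠ 0 → 2 ≤ (f (Sum.inl i)).natDegree
  f_not_selfReciprocal : ∀ j, (f (Sum.inr (Sum.inl j))).reverse ≠ f (Sum.inr (Sum.inl j))
  f_reciprocal : ∀ j, (f (Sum.inr (Sum.inl j))).reverse = f (Sum.inr (Sum.inr j))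
  u : Fin (ρ + 1) ⊕ (Fin ε ⊕ Fin ε) → (ZMod 2)[X]
  v : Fin (ρ + 1) ⊕ (Fin ε ⊕ Fin ε) → (ZMod 2)[X]
  bezout : ∀ i, u i * ((Polynomial.X ^ m₀ - 1) / f i) + v i * f i = 1

noncomputable section

namespace DihedralSetup

variable {m : ℕ} (S : DihedralSetup m)

abbrev Index : Type := Fin (S.ρ + 1) ⊕ (Fin S.ε ⊕ Fin S.ε)

/-- `λ = λ₀ + 2`, so that `4m = 2^λ m₀`. -/
def lam : ℕ := S.lam₀ + 2

/-- `d_i = deg f_i`. -/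
def d (i : S.Index) : ℕ := (S.f i).natDegree

/-- `A_i = 𝔽₂[x]/⟨f_i(x)^{2^λ}⟩`. -/
abbrev A (i : S.Index) : Type := (ZMod 2)[X] ⧸ Ideal.span {S.f i ^ 2 ^ S.lam}

/-- The class in `A_i` of a polynomial. -/
abbrev toA (i : S.Index) : (ZMod 2)[X] →+* S.A i := Ideal.Quotient.mk _

/-- `F_i = (x^{m₀} - 1) / f_i`. -/
def F (i : S.Index) : (ZMod 2)[X] := (Polynomial.X ^ S.m₀ - 1) / S.f i

/-- The idempotent `ε_i = u_i(x^{2^λ}) F_i(x^{2^λ})` of `𝒜`. -/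
def idem (i : S.Index) : CyclicAlgebra m :=
  Ideal.Quotient.mk _ (Polynomial.expand (ZMod 2) (2 ^ S.lam) (S.u i * S.F i))

theorem idem_mul_eq_zero (i : S.Index) (p : (ZMod 2)[X])
    (hp : p ∈ Ideal.span {S.f i ^ 2 ^ S.lam}) :
    S.idem i * Ideal.Quotient.mk _ p = 0 := by
  have hexp : ∀ (k : ℕ) (g : (ZMod 2)[X]), Polynomial.expand (ZMod 2) (2 ^ k) g = g ^ 2 ^ k := by
    intro k
    induction k with
    | zero => intro g; simp
    | succ k ih =>
      intro g
      rw [pow_succ, Polynomial.expand_mul, ZMod.expand_card, map_pow, ih, ← pow_mul]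
  obtain ⟨q, rfl⟩ := Ideal.mem_span_singleton'.1 hp
  rw [idem, ← map_mul, Ideal.Quotient.eq_zero_iff_mem]
  have hdvd : S.f i ∣ Polynomial.X ^ S.m₀ - 1 := by
    rw [S.f_prod]; exact Finset.dvd_prod_of_mem _ (Finset.mem_univ i)
  have hF : S.f i * S.F i = Polynomial.X ^ S.m₀ - 1 :=
    EuclideanDomain.mul_div_cancel' (S.f_irreducible i).ne_zero hdvd
  have h4 : 4 * m = S.m₀ * 2 ^ S.lam := by
    rw [lam, pow_add]; nth_rw 1 [S.m_eq]; ring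
  have hX : (Polynomial.X ^ (4 * m) - 1 : (ZMod 2)[X]) = (S.f i * S.F i) ^ 2 ^ S.lam := by
    rw [hF, ← hexp, map_sub, map_pow, Polynomial.expand_X, map_one, ← pow_mul, h4,
      mul_comm S.m₀]
  rw [hexp, hX]
  exact Ideal.mem_span_singleton'.2 ⟨S.u i ^ 2 ^ S.lam * q, by ring⟩

/-- `φ_i : A_i → 𝒜`, `a(x) ↦ ε_i(x) a(x) mod x^{4m} - 1`. -/
def φ (i : S.Index) : S.A i →ₗ[(ZMod 2)[X]] CyclicAlgebra m :=
  Submodule.liftQ (Ideal.span {S.f i ^ 2 ^ S.lam})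
    (LinearMap.mulLeft (ZMod 2)[X] (S.idem i) ∘ₗ
      (Algebra.linearMap (ZMod 2)[X] (CyclicAlgebra m)))
    (fun p hp => S.idem_mul_eq_zero i p hp)

/-- The inclusion `𝒜 → 𝔽₂[D_{8m}]` sending (the class of) `x` to the generator `x = r 1`. -/
def _root_.cyclicIncl (m : ℕ) : CyclicAlgebra m →+* DihedralAlgebra m :=
  Ideal.Quotient.lift _
    (Polynomial.aeval
      (MonoidAlgebra.of (ZMod 2) (DihedralGroup (4 * m)) (DihedralGroup.r 1))).toRingHom
    (by
      intro p hp
      obtain ⟨q, rfl⟩ := Ideal.mem_span_singleton'.1 hp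
      have h : (DihedralGroup.r 1 : DihedralGroup (4 * m)) ^ (4 * m) = 1 :=
        DihedralGroup.r_one_pow_n
      simp only [AlgHom.toRingHom_eq_coe, RingHom.coe_coe, map_mul, map_sub, map_pow,
        Polynomial.aeval_X, map_one]
      rw [← map_pow, h, map_one, sub_self, mul_zero])

/-- `Θ(α, β) = α + β y`. -/
def _root_.dihedralTheta (m : ℕ) (w : Fin 2 → CyclicAlgebra m) : DihedralAlgebra m :=
  cyclicIncl m (w 0) +
    cyclicIncl m (w 1) * MonoidAlgebra.of (ZMod 2) (DihedralGroup (4 * m)) (DihedralGroup.sr 0)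

/-- Linear codes of length `2` over `A_i`. -/
abbrev LinearCode (i : S.Index) : Type := Submodule (S.A i) (Fin 2 → S.A i)

/-- The concatenated code `𝒜_i □_{φ_i} C = {(φ_i ξ₀, φ_i ξ₁) | (ξ₀, ξ₁) ∈ C} ⊆ 𝒜²`. -/
def concat (i : S.Index) (C : S.LinearCode i) :
    Submodule (ZMod 2)[X] (Fin 2 → CyclicAlgebra m) :=
  (C.restrictScalars (ZMod 2)[X]).map ((S.φ i).compLeft (Fin 2))

/-- `∑_i 𝒜_i □_{φ_i} C_i = ∑_i ε_i C_i`, regarded as a subset of `𝔽₂[D_{8m}]` through `Θ`. -/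
def assemble (C : (i : S.Index) → S.LinearCode i) : Set (DihedralAlgebra m) :=
  dihedralTheta m '' ((⨆ i, S.concat i (C i) :
    Submodule (ZMod 2)[X] (Fin 2 → CyclicAlgebra m)) : Set (Fin 2 → CyclicAlgebra m))

/-- `𝒲_i^{(s)}`: the `w(x)` in `𝔽₂[x]/⟨f_i(x)^s⟩` (polynomials of degree `< s d_i`) with
`w(x) w(x⁻¹) ≡ 1 mod f_i(x)^s`, where `x⁻¹ = x^{4m-1}`. -/
def W (i : S.Index) (s : ℕ) : Set (ZMod 2)[X] :=
  {w | w ∈ Polynomial.degreeLT (ZMod 2) (s * S.d i) ∧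
    S.f i ^ s ∣ w * w.comp (Polynomial.X ^ (4 * m - 1)) - 1}

/-- `G` is a generator matrix of `C`: its rows span `C`, and no row is a linear combination of the
other rows (for the zero code, redundant zero rows are allowed). -/
def IsGeneratorMatrix {i : S.Index} {n : ℕ} (G : Matrix (Fin n) (Fin 2) (S.A i))
    (C : S.LinearCode i) : Prop :=
  Submodule.span (S.A i) (Set.range G.row) = C ∧
    (C ≠ ⊥ → ∀ j, G.row j ∉ Submodule.span (S.A i) (G.row '' {j}ᶜ))

/-- The generator matrices in standard form of the linear codes of length `2` over `A_i`;
`A_i/⟨f_i^s⟩` is the set of the polynomials of degree `< s d_i`. -/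
inductive IsStandard (i : S.Index) : {n : ℕ} → Matrix (Fin n) (Fin 2) (S.A i) → Prop
  | case1 (a : (ZMod 2)[X]) (ha : a ∈ Polynomial.degreeLT (ZMod 2) (2 ^ S.lam * S.d i)) :
      IsStandard i !![1, S.toA i a]
  | case2 (k : ℕ) (hk : 1 ≤ k) (hk' : k ≤ 2 ^ S.lam - 1) (a : (ZMod 2)[X])
      (ha : a ∈ Polynomial.degreeLT (ZMod 2) ((2 ^ S.lam - k) * S.d i)) :
      IsStandard i !![S.toA i (S.f i ^ k), S.toA i (S.f i ^ k * a)]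
  | case3 (b : (ZMod 2)[X]) (hb : b ∈ Polynomial.degreeLT (ZMod 2) ((2 ^ S.lam - 1) * S.d i)) :
      IsStandard i !![S.toA i (S.f i * b), 1]
  | case4 (k : ℕ) (hk : 1 ≤ k) (hk' : k ≤ 2 ^ S.lam - 1) (b : (ZMod 2)[X])
      (hb : b ∈ Polynomial.degreeLT (ZMod 2) ((2 ^ S.lam - k - 1) * S.d i)) :
      IsStandard i !![S.toA i (S.f i ^ (k + 1) * b), S.toA i (S.f i ^ k)]
  | case5 (k : ℕ) (hk : k ≤ 2 ^ S.lam) :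
      IsStandard i !![S.toA i (S.f i ^ k), 0; 0, S.toA i (S.f i ^ k)]
  | case6 (j : ℕ) (hj : 1 ≤ j) (hj' : j ≤ 2 ^ S.lam - 1) (c : (ZMod 2)[X])
      (hc : c ∈ Polynomial.degreeLT (ZMod 2) (j * S.d i)) :
      IsStandard i !![1, S.toA i c; 0, S.toA i (S.f i ^ j)]
  | case7 (k j : ℕ) (hk : 1 ≤ k) (hk' : k ≤ 2 ^ S.lam - 2) (hj : 1 ≤ j)
      (hj' : j ≤ 2 ^ S.lam - k - 1) (c : (ZMod 2)[X])
      (hc : c ∈ Polynomial.degreeLT (ZMod 2) (j * S.d i)) :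
      IsStandard i !![S.toA i (S.f i ^ k), S.toA i (S.f i ^ k * c); 0, S.toA i (S.f i ^ (k + j))]
  | case8 (j : ℕ) (hj : 1 ≤ j) (hj' : j ≤ 2 ^ S.lam - 1) (c : (ZMod 2)[X])
      (hc : c ∈ Polynomial.degreeLT (ZMod 2) (j * S.d i)) (hfc : S.f i ∣ c) :
      IsStandard i !![S.toA i c, 1; S.toA i (S.f i ^ j), 0]
  | case9 (k j : ℕ) (hk : 1 ≤ k) (hk' : k ≤ 2 ^ S.lam - 2) (hj : 1 ≤ j)
      (hj' : j ≤ 2 ^ S.lam - k - 1) (c : (ZMod 2)[X])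
      (hc : c ∈ Polynomial.degreeLT (ZMod 2) (j * S.d i)) (hfc : S.f i ∣ c) :
      IsStandard i !![S.toA i (S.f i ^ k * c), S.toA i (S.f i ^ k); S.toA i (S.f i ^ (k + j)), 0]

/-- The five families of generator matrices for the self-reciprocal indices `0 ≤ i ≤ ρ`. -/
inductive IsSymmetric (i : Fin (S.ρ + 1)) :
    {n : ℕ} → Matrix (Fin n) (Fin 2) (S.A (Sum.inl i)) → Prop
  | caseI (a : (ZMod 2)[X]) (ha : a ∈ S.W (Sum.inl i) (2 ^ S.lam)) :
      IsSymmetric i !![1, S.toA _ a]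
  | caseII (k : ℕ) (hk : 1 ≤ k) (hk' : k ≤ 2 ^ S.lam - 1) (a : (ZMod 2)[X])
      (ha : a ∈ S.W (Sum.inl i) (2 ^ S.lam - k)) :
      IsSymmetric i !![S.toA _ (S.f (Sum.inl i) ^ k), S.toA _ (S.f (Sum.inl i) ^ k * a)]
  | caseIII (k : ℕ) (hk : k ≤ 2 ^ S.lam) :
      IsSymmetric i !![S.toA _ (S.f (Sum.inl i) ^ k), 0; 0, S.toA _ (S.f (Sum.inl i) ^ k)]
  | caseIV (j : ℕ) (hj : 1 ≤ j) (hj' : j ≤ 2 ^ S.lam - 1) (c : (ZMod 2)[X])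
      (hc : c ∈ S.W (Sum.inl i) j) :
      IsSymmetric i !![1, S.toA _ c; 0, S.toA _ (S.f (Sum.inl i) ^ j)]
  | caseV (k j : ℕ) (hk : 1 ≤ k) (hk' : k ≤ 2 ^ S.lam - 2) (hj : 1 ≤ j)
      (hj' : j ≤ 2 ^ S.lam - k - 1) (c : (ZMod 2)[X]) (hc : c ∈ S.W (Sum.inl i) j) :
      IsSymmetric i !![S.toA _ (S.f (Sum.inl i) ^ k), S.toA _ (S.f (Sum.inl i) ^ k * c);
        0, S.toA _ (S.f (Sum.inl i) ^ (k + j))]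

/-- The families `(C_i)` that the construction allows: for `i ≤ ρ` a code with one of the five
kinds of generator matrices; for `ρ < i ≤ ρ + ε` a code with a generator matrix in standard form,
and `C_{i+ε} = {(b(x⁻¹), a(x⁻¹)) | (a(x), b(x)) ∈ C_i}`, where `x⁻¹ = x^{4m-1}`. -/
def IsAdmissible (C : (i : S.Index) → S.LinearCode i) : Prop :=
  (∀ i : Fin (S.ρ + 1), ∃ (n : ℕ) (G : Matrix (Fin n) (Fin 2) (S.A (Sum.inl i))),
    S.IsSymmetric i G ∧ S.IsGeneratorMatrix G (C (Sum.inl i))) ∧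
  (∀ j : Fin S.ε, ∃ (n : ℕ) (G : Matrix (Fin n) (Fin 2) (S.A (Sum.inr (Sum.inl j)))),
    S.IsStandard (Sum.inr (Sum.inl j)) G ∧ S.IsGeneratorMatrix G (C (Sum.inr (Sum.inl j)))) ∧
  (∀ j : Fin S.ε, (C (Sum.inr (Sum.inr j)) : Set (Fin 2 → S.A (Sum.inr (Sum.inr j)))) =
    {w | ∃ a b : (ZMod 2)[X],
      ![S.toA (Sum.inr (Sum.inl j)) a, S.toA (Sum.inr (Sum.inl j)) b] ∈ C (Sum.inr (Sum.inl j)) ∧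
      w = ![S.toA (Sum.inr (Sum.inr j)) (b.comp (Polynomial.X ^ (4 * m - 1))),
        S.toA (Sum.inr (Sum.inr j)) (a.comp (Polynomial.X ^ (4 * m - 1)))]})

open Classical in
/-- The `f_i`-degree `‖a‖` of `a ∈ A_i`: the index of the first nonzero digit of the `f_i`-adic
expansion of `a`, and `2^λ` if `a = 0`; that is, the largest `j ≤ 2^λ` with `a ∈ f_i^j A_i`. -/
def fDegree (i : S.Index) (a : S.A i) : ℕ :=
  Nat.findGreatest (fun j => S.toA i (S.f i ^ j) ∣ a) (2 ^ S.lam)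

/-- The `f_i`-degree of a vector. -/
def vecDegree (i : S.Index) (w : Fin 2 → S.A i) : ℕ :=
  min (S.fDegree i (w 0)) (S.fDegree i (w 1))

/-- `∏_α 2^{(2^λ - ‖α‖) d_i}`, over the rows `α` of `G`. -/
def rowCount {i : S.Index} {n : ℕ} (G : Matrix (Fin n) (Fin 2) (S.A i)) : ℕ :=
  ∏ j, 2 ^ ((2 ^ S.lam - S.vecDegree i (G.row j)) * S.d i)

/-- `S_{(2,2^{d_i},2^λ)}`. -/
def numSymmetric (i : Fin (S.ρ + 1)) : ℕ :=
  1 + 2 ^ S.lam +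
    ∑ j ∈ Finset.Icc 1 (2 ^ S.lam), (2 ^ S.lam - j + 1) * (S.W (Sum.inl i) j).ncard

/-- `𝓛_{(2,2^{d_i},2^λ)}`. -/
def numLinear (i : S.Index) : ℕ :=
  ∑ k ∈ Finset.Icc 0 (2 ^ S.lam), (2 * k + 1) * 2 ^ ((2 ^ S.lam - k) * S.d i)

end DihedralSetup

end

/-!
Writing an element of `𝔽₂[D_{8m}]` as `α(x) + β(x) y` identifies it with a pair
`(α, β) ∈ 𝒜²`. Since `y α(x) = α(x⁻¹) y` and `y² = 1`, the left ideals correspond to the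
`𝔽₂[x]`-submodules of `𝒜²` that are stable under `(α, β) ↦ (β(x⁻¹), α(x⁻¹))`
(`exists_isBarStableSubmodule`, `IsBarStableSubmodule.exists_ideal`).

As `x^{4m} - 1 = ∏ f_i^{2^λ}`, the idempotents `ε_i` realise the Chinese remainder decomposition
`𝒜 ≅ ∏ A_i`, so a submodule of `𝒜²` is the same as a family of codes `C_i ⊆ A_i²`
(`mem_iSup_concat_iff`, `exists_eq_iSup_concat`). The substitution `x ↦ x⁻¹` carries `A_i` to
`A_{i'}` with `f_{i'} = f_i^*`. Hence stability of the submodule means that `C_i` is stable for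
the self-reciprocal `f_i`, whereas for a reciprocal pair of factors one of the two codes is
arbitrary and determines the other (`isBarStableFamily_iff_isAdmissible`).

It remains to classify the codes of length two over the chain ring `A_i`. Taking `k` maximal with
`C ⊆ f_i^k A_i²`, one finds in `C` a vector that is `f_i^k` times `(1, c)` or `(c, 1)`, and in the
second case one may assume `f_i ∣ c`. The remaining freedom is an ideal of `A_i`, so that
`C = f_i^k (A_i (1, c) + f_i^j A_i²)`, up to interchanging the coordinates, where `k`, `j` and
`c` modulo `f_i^j` are determined by `C` (`exists_normalForm`, `normalCode_injective`,
`normalCode_ne_swapCode`). The listed generator matrices are exactly these normal forms, sorted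
according to whether `k`, `j` and `2^λ - k - j` vanish. Such a code is stable if and only if
`c(x) c(x⁻¹) ≡ 1` modulo `f_i^j`, and the interchanged form with `j ≥ 1` and `f_i ∣ c` is never
stable. The enumeration formulas count the triples `(k, j, c)`.
-/

noncomputable section

/-! ### The substitution `x ↦ x⁻¹` -/

/-- The substitution `x ↦ x^{4m-1}` in `𝔽₂[x]`, which induces `x ↦ x⁻¹` on every quotient of
`𝔽₂[x]` in which `x^{4m} = 1`. -/
def polyBar (m : ℕ) : (ZMod 2)[X] →+* (ZMod 2)[X] :=
  Polynomial.compRingHom (Polynomial.X ^ (4 * m - 1))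

theorem polyBar_apply (m : ℕ) (p : (ZMod 2)[X]) :
    polyBar m p = p.comp (Polynomial.X ^ (4 * m - 1)) := rfl

theorem dvd_comp_sub_comp {R : Type*} [CommRing R] (p q r : R[X]) :
    q - r ∣ p.comp q - p.comp r := by
  have h := Polynomial.sub_dvd_eval_sub q r (p.map Polynomial.C)
  rwa [Polynomial.eval_map, Polynomial.eval_map] at h

theorem X_pow_sub_one_dvd_polyBar_polyBar_sub {m : ℕ} (hm : 0 < m) (p : (ZMod 2)[X]) :
    (Polynomial.X ^ (4 * m) - 1 : (ZMod 2)[X]) ∣ polyBar m (polyBar m p) - p := by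
  -- the exponent of the iterated substitution is `1` modulo `4m`
  obtain ⟨n, hn⟩ : ∃ n, (4 * m - 1) * (4 * m - 1) = 4 * m * n + 1 := by
    obtain ⟨k, rfl⟩ : ∃ k, m = k + 1 := ⟨m - 1, by omega⟩
    refine ⟨4 * k + 2, ?_⟩
    rw [show 4 * (k + 1) - 1 = 4 * k + 3 by omega]; ring
  have h1 : polyBar m (polyBar m p) - p =
      p.comp (Polynomial.X ^ ((4 * m - 1) * (4 * m - 1))) - p.comp Polynomial.X := by
    rw [polyBar_apply, polyBar_apply, Polynomial.comp_assoc, Polynomial.X_pow_comp, ← pow_mul,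
      Polynomial.comp_X]
  rw [h1, hn]
  refine dvd_trans ?_ (dvd_comp_sub_comp _ _ _)
  have h2 : (Polynomial.X ^ (4 * m * n + 1) - Polynomial.X : (ZMod 2)[X]) =
      ((Polynomial.X ^ (4 * m)) ^ n - 1) * Polynomial.X := by
    rw [pow_succ, pow_mul, sub_mul, one_mul]
  rw [h2]
  exact Dvd.dvd.mul_right (sub_one_dvd_pow_sub_one (Polynomial.X ^ (4 * m) : (ZMod 2)[X]) n) _

/-- Modulo `x^{4m} - 1`, the reciprocal polynomial is `x^{deg p} p(x⁻¹)`. -/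
theorem X_pow_sub_one_dvd_X_pow_mul_polyBar_sub_reverse {m : ℕ} (hm : 0 < m) (p : (ZMod 2)[X]) :
    (Polynomial.X ^ (4 * m) - 1 : (ZMod 2)[X]) ∣
      Polynomial.X ^ p.natDegree * polyBar m p - p.reverse := by
  set I : Ideal (ZMod 2)[X] := Ideal.span {(Polynomial.X ^ (4 * m) - 1 : (ZMod 2)[X])}
  rw [← Ideal.mem_span_singleton, ← Ideal.Quotient.mk_eq_mk_iff_sub_mem]
  set q : (ZMod 2)[X] →+* (ZMod 2)[X] ⧸ I := Ideal.Quotient.mk I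
  have hx : q Polynomial.X ^ (4 * m) = 1 := by
    rw [← map_pow, ← map_one q, Ideal.Quotient.mk_eq_mk_iff_sub_mem]
    exact Ideal.mem_span_singleton_self _
  have hx1 : q Polynomial.X * q Polynomial.X ^ (4 * m - 1) = 1 := by
    rw [← pow_succ', Nat.sub_add_cancel (by omega), hx]
  have hev : ∀ (r s : (ZMod 2)[X]), q (r.comp s) = r.eval₂ (q.comp Polynomial.C) (q s) := by
    intro r s
    rw [Polynomial.comp, Polynomial.hom_eval₂]
  let inv : Invertible (q Polynomial.X ^ (4 * m - 1)) :=
    ⟨q Polynomial.X, hx1, by rw [mul_comm, hx1]⟩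
  have h := Polynomial.eval₂_reverse_mul_pow (q.comp Polynomial.C) (q Polynomial.X ^ (4 * m - 1)) p
  have hinv : ⅟ (q Polynomial.X ^ (4 * m - 1)) = q Polynomial.X := rfl
  rw [hinv, ← hev, Polynomial.comp_X, ← map_pow, ← hev, map_pow] at h
  rw [map_mul, map_pow, polyBar_apply, ← h, mul_left_comm, ← mul_pow, hx1, one_pow, mul_one]

namespace DihedralSetup

variable {m : ℕ} (S : DihedralSetup m)

theorem m_pos {m : ℕ} (S : DihedralSetup m) : 0 < m := by
  have h : 0 < S.m₀ := S.m₀_odd.pos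
  have h2 := S.m_eq
  rw [h2]; positivity

theorem four_mul_eq : 4 * m = S.m₀ * 2 ^ S.lam := by
  rw [lam, pow_add]; nth_rw 1 [S.m_eq]; ring

theorem X_pow_four_mul_sub_one :
    (Polynomial.X ^ (4 * m) - 1 : (ZMod 2)[X]) = (Polynomial.X ^ S.m₀ - 1) ^ 2 ^ S.lam := by
  rw [sub_pow_char_pow, one_pow, ← pow_mul, ← S.four_mul_eq]

theorem f_dvd (i : S.Index) : S.f i ∣ Polynomial.X ^ S.m₀ - 1 := by
  rw [S.f_prod]; exact Finset.dvd_prod_of_mem _ (Finset.mem_univ i)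

theorem f_mul_F (i : S.Index) : S.f i * S.F i = Polynomial.X ^ S.m₀ - 1 :=
  EuclideanDomain.mul_div_cancel' (S.f_irreducible i).ne_zero (S.f_dvd i)

theorem f_pow_dvd (i : S.Index) :
    S.f i ^ 2 ^ S.lam ∣ (Polynomial.X ^ (4 * m) - 1 : (ZMod 2)[X]) := by
  rw [S.X_pow_four_mul_sub_one]; exact pow_dvd_pow_of_dvd (S.f_dvd i) _

theorem f_prime (i : S.Index) : Prime (S.f i) := (S.f_irreducible i).prime

theorem f_ne_zero (i : S.Index) : S.f i ≠ 0 := (S.f_irreducible i).ne_zero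

theorem isCoprime_f_X (i : S.Index) : IsCoprime (S.f i) Polynomial.X := by
  obtain ⟨q, hq⟩ := S.f_dvd i
  have h : Polynomial.X ^ S.m₀ = (Polynomial.X ^ (S.m₀ - 1) * Polynomial.X : (ZMod 2)[X]) := by
    rw [← pow_succ, Nat.sub_add_cancel S.m₀_odd.pos]
  exact ⟨-q, Polynomial.X ^ (S.m₀ - 1), by rw [← h]; linear_combination hq⟩

theorem coeff_zero_f (i : S.Index) : (S.f i).coeff 0 ≠ 0 := by
  intro h
  have h1 := (S.isCoprime_f_X i).symm.isUnit_of_dvd (Polynomial.X_dvd_iff.2 h)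
  exact Polynomial.not_isUnit_X h1

/-- The involution of the index set with `f_{star i} = f_i^*`. -/
def star : S.Index → S.Index
  | Sum.inl i => Sum.inl i
  | Sum.inr (Sum.inl j) => Sum.inr (Sum.inr j)
  | Sum.inr (Sum.inr j) => Sum.inr (Sum.inl j)

theorem star_inr_inl (j : Fin S.ε) : S.star (Sum.inr (Sum.inl j)) = Sum.inr (Sum.inr j) := rfl

theorem star_inr_inr (j : Fin S.ε) : S.star (Sum.inr (Sum.inr j)) = Sum.inr (Sum.inl j) := rfl

theorem star_star (i : S.Index) : S.star (S.star i) = i := by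
  rcases i with i | j | j <;> rfl

theorem f_star (i : S.Index) : S.f (S.star i) = (S.f i).reverse := by
  rcases i with i | j | j
  · exact (S.f_selfReciprocal i).symm
  · exact (S.f_reciprocal j).symm
  · rw [← S.f_reciprocal j]
    have h := S.coeff_zero_f (Sum.inr (Sum.inl j))
    have h0 : (S.f (Sum.inr (Sum.inl j))).natTrailingDegree = 0 :=
      Polynomial.natTrailingDegree_eq_zero.2 (Or.inr h)
    change S.f (Sum.inr (Sum.inl j)) = _
    conv_rhs => rw [Polynomial.reverse, Polynomial.reverse_natDegree, h0, Nat.sub_zero,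
      Polynomial.reverse, Polynomial.reflect_reflect]

theorem dvd_X_pow_mul_polyBar_f_sub (i : S.Index) :
    S.f (S.star i) ^ 2 ^ S.lam ∣
      Polynomial.X ^ S.d i * polyBar m (S.f i) - S.f (S.star i) := by
  have h := X_pow_sub_one_dvd_X_pow_mul_polyBar_sub_reverse S.m_pos (S.f i)
  rw [← S.f_star] at h
  exact (S.f_pow_dvd _).trans h

/-- `f_i^*` divides `x^{d_i} f_i(x⁻¹)` and is prime to `x`. -/
theorem f_star_dvd_polyBar_f (i : S.Index) : S.f (S.star i) ∣ polyBar m (S.f i) := by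
  have h := (dvd_pow_self (S.f (S.star i)) (pow_ne_zero S.lam two_ne_zero)).trans
    (S.dvd_X_pow_mul_polyBar_f_sub i)
  have h1 := (dvd_sub_left (dvd_refl _)).1 h
  exact (IsCoprime.pow_right (S.isCoprime_f_X _)).dvd_of_dvd_mul_left h1

theorem f_star_pow_dvd_polyBar {i : S.Index} {s : ℕ} {q : (ZMod 2)[X]} (h : S.f i ^ s ∣ q) :
    S.f (S.star i) ^ s ∣ polyBar m q := by
  have h1 := map_dvd (polyBar m) h
  rw [map_pow] at h1
  exact (pow_dvd_pow_of_dvd (S.f_star_dvd_polyBar_f i) s).trans h1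

/-- `f_i(x⁻¹)` and `f_i^*` differ by a unit modulo `f_i^{* 2^λ}`. -/
theorem f_star_pow_dvd_of_dvd_polyBar_mul {i : S.Index} {k j : ℕ} (hkj : k + j ≤ 2 ^ S.lam)
    {z : (ZMod 2)[X]} (h : S.f (S.star i) ^ (k + j) ∣ polyBar m (S.f i) ^ k * z) :
    S.f (S.star i) ^ j ∣ z := by
  have h1 : S.f (S.star i) ^ (k + j) ∣
      (Polynomial.X ^ S.d i * polyBar m (S.f i)) ^ k - S.f (S.star i) ^ k :=
    ((pow_dvd_pow _ hkj).trans (S.dvd_X_pow_mul_polyBar_f_sub i)).trans (sub_dvd_pow_sub_pow _ _ _)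
  have h2 : S.f (S.star i) ^ (k + j) ∣ S.f (S.star i) ^ k * z := by
    have h4 := dvd_sub (h.mul_left ((Polynomial.X ^ S.d i) ^ k)) (h1.mul_right z)
    convert h4 using 1
    ring
  rw [pow_add] at h2
  exact (mul_dvd_mul_iff_left (pow_ne_zero _ (S.f_ne_zero _))).1 h2

/-! ### Codes of length two over `A_i` -/

theorem toA_eq_toA_iff {i : S.Index} {a b : (ZMod 2)[X]} :
    S.toA i a = S.toA i b ↔ S.f i ^ 2 ^ S.lam ∣ a - b := by
  rw [Ideal.Quotient.mk_eq_mk_iff_sub_mem, Ideal.mem_span_singleton]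

theorem toA_eq_zero_iff {i : S.Index} {a : (ZMod 2)[X]} :
    S.toA i a = 0 ↔ S.f i ^ 2 ^ S.lam ∣ a := by
  rw [Ideal.Quotient.eq_zero_iff_mem, Ideal.mem_span_singleton]

theorem exists_eq_toA {i : S.Index} (w : Fin 2 → S.A i) :
    ∃ a b, w = ![S.toA i a, S.toA i b] := by
  obtain ⟨a, ha⟩ := Ideal.Quotient.mk_surjective (w 0)
  obtain ⟨b, hb⟩ := Ideal.Quotient.mk_surjective (w 1)
  refine ⟨a, b, ?_⟩
  ext t
  fin_cases t
  · exact ha.symm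
  · exact hb.symm

variable {S} in
theorem linearCode_ext {i : S.Index} {C D : S.LinearCode i}
    (h : ∀ a b, ![S.toA i a, S.toA i b] ∈ C ↔ ![S.toA i a, S.toA i b] ∈ D) : C = D := by
  ext w
  obtain ⟨a, b, rfl⟩ := S.exists_eq_toA w
  exact h a b

theorem smul_toA_vec {i : S.Index} (x a b : (ZMod 2)[X]) :
    S.toA i x • ![S.toA i a, S.toA i b] = ![S.toA i (x * a), S.toA i (x * b)] := by
  simp only [map_mul, Matrix.smul_cons, smul_eq_mul, Matrix.smul_empty]

theorem toA_vec_add {i : S.Index} (a b a' b' : (ZMod 2)[X]) :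
    ![S.toA i a, S.toA i b] + ![S.toA i a', S.toA i b'] =
      ![S.toA i (a + a'), S.toA i (b + b')] := by
  simp only [map_add, Matrix.cons_add_cons, Matrix.empty_add_empty]

theorem toA_vec_eq_iff {i : S.Index} {a b a' b' : (ZMod 2)[X]} :
    ![S.toA i a, S.toA i b] = ![S.toA i a', S.toA i b'] ↔
      S.f i ^ 2 ^ S.lam ∣ a - a' ∧ S.f i ^ 2 ^ S.lam ∣ b - b' := by
  rw [← toA_eq_toA_iff, ← toA_eq_toA_iff]
  constructor
  · intro h
    exact ⟨congrFun h 0, congrFun h 1⟩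
  · rintro ⟨h1, h2⟩
    rw [h1, h2]

/-- The code `f_i^k (A_i (1, c) + f_i^j A_i²)`. -/
def normalCode (i : S.Index) (k j : ℕ) (c : (ZMod 2)[X]) : S.LinearCode i :=
  Submodule.span (S.A i) {![S.toA i (S.f i ^ k), S.toA i (S.f i ^ k * c)],
    ![0, S.toA i (S.f i ^ (k + j))]}

theorem mem_normalCode {i : S.Index} {k j : ℕ} (hkj : k + j ≤ 2 ^ S.lam) {a b c : (ZMod 2)[X]} :
    ![S.toA i a, S.toA i b] ∈ S.normalCode i k j c ↔
      S.f i ^ k ∣ a ∧ S.f i ^ (k + j) ∣ b - c * a := by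
  have hk : S.f i ^ k ∣ S.f i ^ 2 ^ S.lam := pow_dvd_pow _ (by omega)
  have hj : S.f i ^ (k + j) ∣ S.f i ^ 2 ^ S.lam := pow_dvd_pow _ hkj
  rw [normalCode, Submodule.mem_span_pair, ← map_zero (S.toA i)]
  constructor
  · rintro ⟨x, y, h⟩
    obtain ⟨x, rfl⟩ := Ideal.Quotient.mk_surjective x
    obtain ⟨y, rfl⟩ := Ideal.Quotient.mk_surjective y
    rw [smul_toA_vec, smul_toA_vec, toA_vec_add, toA_vec_eq_iff] at h
    obtain ⟨h1, h2⟩ := h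
    constructor
    · have h3 := dvd_sub (Dvd.intro_left (x + y * 0) rfl : S.f i ^ k ∣ (x + y * 0) * S.f i ^ k)
        (hk.trans h1)
      convert h3 using 1
      ring
    · obtain ⟨u, hu⟩ := hj.trans h1
      obtain ⟨v, hv⟩ := hj.trans h2
      exact ⟨y - v + c * u, by linear_combination c * hu - hv⟩
  · rintro ⟨⟨x, hx⟩, ⟨y, hy⟩⟩
    refine ⟨S.toA i x, S.toA i y, ?_⟩
    rw [smul_toA_vec, smul_toA_vec, toA_vec_add, toA_vec_eq_iff]
    constructor
    · convert dvd_zero _ using 1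
      linear_combination -hx
    · convert dvd_zero _ using 1
      linear_combination -hy - c * hx

theorem normalCode_congr {i : S.Index} {k j : ℕ} (hkj : k + j ≤ 2 ^ S.lam) {c c' : (ZMod 2)[X]}
    (h : S.f i ^ j ∣ c - c') : S.normalCode i k j c = S.normalCode i k j c' := by
  refine linearCode_ext fun a b => ?_
  rw [S.mem_normalCode hkj, S.mem_normalCode hkj]
  refine and_congr_right fun ha => ?_
  refine dvd_iff_dvd_of_dvd_sub ?_
  rw [pow_add]
  convert (mul_dvd_mul ha h).neg_right using 1
  ring

/-- Interchange of the two coordinates. -/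
def swapEquiv (i : S.Index) : (Fin 2 → S.A i) ≃ₗ[S.A i] (Fin 2 → S.A i) :=
  LinearEquiv.funCongrLeft (S.A i) (S.A i) (Equiv.swap 0 1)

theorem swapEquiv_apply {i : S.Index} (a b : S.A i) : S.swapEquiv i ![a, b] = ![b, a] := by
  ext t
  fin_cases t <;> simp [swapEquiv, LinearMap.funLeft]

/-- The code obtained by interchanging the two coordinates. -/
def swapCode {i : S.Index} (C : S.LinearCode i) : S.LinearCode i :=
  C.map (S.swapEquiv i : (Fin 2 → S.A i) →ₗ[S.A i] (Fin 2 → S.A i))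

theorem mem_swapCode {i : S.Index} {C : S.LinearCode i} {a b : S.A i} :
    ![a, b] ∈ S.swapCode C ↔ ![b, a] ∈ C := by
  rw [swapCode, ← S.swapEquiv_apply b a, Submodule.mem_map_equiv, LinearEquiv.symm_apply_apply]

theorem swapCode_swapCode {i : S.Index} (C : S.LinearCode i) : S.swapCode (S.swapCode C) = C :=
  linearCode_ext fun _ _ => by rw [mem_swapCode, mem_swapCode]

theorem swapCode_injective (i : S.Index) :
    Function.Injective (S.swapCode : S.LinearCode i → S.LinearCode i) :=
  Function.LeftInverse.injective S.swapCode_swapCode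

theorem card_swapCode {i : S.Index} (C : S.LinearCode i) :
    Nat.card (S.swapCode C) = Nat.card C :=
  Nat.card_congr ((S.swapEquiv i).submoduleMap C).symm.toEquiv

theorem swapCode_normalCode {i : S.Index} (k j : ℕ) (c : (ZMod 2)[X]) :
    S.swapCode (S.normalCode i k j c) =
      Submodule.span (S.A i) {![S.toA i (S.f i ^ k * c), S.toA i (S.f i ^ k)],
        ![S.toA i (S.f i ^ (k + j)), 0]} := by
  rw [swapCode, normalCode, Submodule.map_span, Set.image_pair]
  simp only [LinearEquiv.coe_coe, swapEquiv_apply]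

theorem isCoprime_f_pow {i : S.Index} {a : (ZMod 2)[X]} (h : ¬ S.f i ∣ a) (n : ℕ) :
    IsCoprime a (S.f i ^ n) :=
  (((S.f_irreducible i).coprime_iff_not_dvd).2 h).symm.pow_right

/-- The main step of the classification: if `C ⊆ f_i^k A_i²` and `f_i^k` is the exact power of
`f_i` in the first coordinate of some codeword, then that codeword is, up to a unit, `f_i^k (1, c)`,
and the codewords with vanishing first coordinate supply the multiples of `f_i^{k+j} (0, 1)`. -/
theorem exists_eq_normalCode {i : S.Index} {C : S.LinearCode i} {k : ℕ}
    (hC : ∀ a b, ![S.toA i a, S.toA i b] ∈ C → S.f i ^ k ∣ a ∧ S.f i ^ k ∣ b)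
    {a b : (ZMod 2)[X]} (hab : ![S.toA i a, S.toA i b] ∈ C) (ha : ¬ S.f i ^ (k + 1) ∣ a) :
    ∃ j c, k + j ≤ 2 ^ S.lam ∧ C = S.normalCode i k j c := by
  obtain ⟨⟨a', rfl⟩, ⟨b', rfl⟩⟩ := hC _ _ hab
  have ha' : ¬ S.f i ∣ a' := fun h => ha (by rw [pow_succ]; exact mul_dvd_mul_left _ h)
  obtain ⟨u, v, huv⟩ := S.isCoprime_f_pow ha' (2 ^ S.lam)
  have hgen : ![S.toA i (S.f i ^ k), S.toA i (S.f i ^ k * (u * b'))] ∈ C := by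
    convert C.smul_mem (S.toA i u) hab using 1
    rw [smul_toA_vec, toA_vec_eq_iff]
    exact ⟨⟨S.f i ^ k * v, by linear_combination -S.f i ^ k * huv⟩, ⟨0, by ring⟩⟩
  -- the second coordinates of the codewords whose first coordinate vanishes
  let J : Ideal (ZMod 2)[X] :=
    { carrier := {y | ![S.toA i 0, S.toA i y] ∈ C}
      add_mem' := by
        intro x y hx hy
        have h := C.add_mem hx hy
        rwa [toA_vec_add, add_zero] at h
      zero_mem' := by
        have h := C.zero_mem
        change ![S.toA i 0, S.toA i 0] ∈ C
        convert h using 1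
        ext t
        fin_cases t <;> simp
      smul_mem' := by
        intro x y hy
        have h := C.smul_mem (S.toA i x) hy
        rwa [smul_toA_vec, mul_zero] at h }
  have hJ : ∀ y, y ∈ J ↔ ![S.toA i 0, S.toA i y] ∈ C := fun _ => Iff.rfl
  -- `J` contains `f_i^{2^λ}`, so it is generated by a power of `f_i`
  have hNJ : S.f i ^ 2 ^ S.lam ∈ J := by
    rw [hJ]
    convert C.zero_mem using 1
    rw [S.toA_eq_zero_iff.2 dvd_rfl, map_zero]
    ext t
    fin_cases t <;> rfl
  obtain ⟨g, hg⟩ := (IsPrincipalIdealRing.principal J).principal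
  have hgN : g ∣ S.f i ^ 2 ^ S.lam := by
    rw [hg] at hNJ; exact Ideal.mem_span_singleton.1 hNJ
  obtain ⟨t, htN, hgt⟩ := (dvd_prime_pow (S.f_prime i) _).1 hgN
  have hJt : ∀ y, y ∈ J ↔ S.f i ^ t ∣ y := by
    intro y
    rw [hg]
    exact Ideal.mem_span_singleton.trans hgt.dvd_iff_dvd_left
  have hkt : k ≤ t := by
    have h := (hC _ _ ((hJ _).1 ((hJt _).2 dvd_rfl))).2
    exact (pow_dvd_pow_iff (S.f_ne_zero i) (S.f_prime i).not_isUnit).1 h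
  obtain ⟨j, rfl⟩ := Nat.exists_eq_add_of_le hkt
  refine ⟨j, u * b', htN, linearCode_ext fun x y => ?_⟩
  rw [S.mem_normalCode htN]
  have key : ∀ z, ![S.toA i (S.f i ^ k * z), S.toA i y] ∈ C ↔
      S.f i ^ (k + j) ∣ y - u * b' * (S.f i ^ k * z) := by
    intro z
    rw [← hJt, hJ]
    have h1 := C.smul_mem (S.toA i z) hgen
    rw [smul_toA_vec] at h1
    rw [← Submodule.add_mem_iff_right C (y := ![S.toA i 0, S.toA i _]) h1, toA_vec_add,
      add_zero, mul_comm z (S.f i ^ k),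
      show z * (S.f i ^ k * (u * b')) + (y - u * b' * (S.f i ^ k * z)) = y by ring]
  constructor
  · intro h
    obtain ⟨⟨z, rfl⟩, -⟩ := hC _ _ h
    exact ⟨Dvd.intro _ rfl, (key z).1 h⟩
  · rintro ⟨⟨z, rfl⟩, h⟩
    exact (key z).2 h

theorem degreeLT_eq_of_dvd_sub {i : S.Index} {j : ℕ} {c c' : (ZMod 2)[X]}
    (hc : c ∈ Polynomial.degreeLT (ZMod 2) (j * S.d i))
    (hc' : c' ∈ Polynomial.degreeLT (ZMod 2) (j * S.d i)) (h : S.f i ^ j ∣ c - c') : c = c' := by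
  rw [← sub_eq_zero]
  refine Polynomial.eq_zero_of_dvd_of_degree_lt h ?_
  have h1 := Polynomial.mem_degreeLT.1 (Submodule.sub_mem _ hc hc')
  rwa [Polynomial.degree_pow, Polynomial.degree_eq_natDegree (S.f_ne_zero i), nsmul_eq_mul,
    ← Nat.cast_mul]

theorem exists_mem_degreeLT_dvd_sub (i : S.Index) (j : ℕ) (c : (ZMod 2)[X]) :
    ∃ c' ∈ Polynomial.degreeLT (ZMod 2) (j * S.d i), S.f i ^ j ∣ c - c' := by
  refine ⟨c % S.f i ^ j, ?_, ?_⟩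
  · rw [Polynomial.mem_degreeLT]
    have h := EuclideanDomain.mod_lt c (pow_ne_zero j (S.f_ne_zero i))
    have h1 : (c % S.f i ^ j).degree < (S.f i ^ j).degree := h
    rwa [Polynomial.degree_pow, Polynomial.degree_eq_natDegree (S.f_ne_zero i), nsmul_eq_mul,
      ← Nat.cast_mul] at h1
  · exact ⟨c / S.f i ^ j, by linear_combination -EuclideanDomain.div_add_mod c (S.f i ^ j)⟩

/-- Every code of length two is `f_i^k (A_i (1, c) + f_i^j A_i²)` with `c` reduced modulo `f_i^j`,
or is obtained from such a code with `f_i ∣ c` and `j ≥ 1` by interchanging the coordinates. -/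
theorem exists_normalForm {i : S.Index} (C : S.LinearCode i) :
    (∃ k j c, k + j ≤ 2 ^ S.lam ∧ c ∈ Polynomial.degreeLT (ZMod 2) (j * S.d i) ∧
      C = S.normalCode i k j c) ∨
    (∃ k j b, k + (j + 1) ≤ 2 ^ S.lam ∧ b ∈ Polynomial.degreeLT (ZMod 2) (j * S.d i) ∧
      C = S.swapCode (S.normalCode i k (j + 1) (S.f i * b))) := by
  classical
  obtain ⟨N, hN⟩ : ∃ N, N = 2 ^ S.lam := ⟨_, rfl⟩
  let P : ℕ → Prop := fun k => ∀ a b, ![S.toA i a, S.toA i b] ∈ C → S.f i ^ k ∣ a ∧ S.f i ^ k ∣ b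
  have hP0 : P 0 := fun a b _ => by simp
  obtain ⟨k, hk⟩ : ∃ k, k = Nat.findGreatest P N := ⟨_, rfl⟩
  have hkN : k ≤ N := hk ▸ Nat.findGreatest_le N
  have hPk : P k := hk ▸ Nat.findGreatest_spec (Nat.zero_le N) hP0
  have hex : ∃ a b, ![S.toA i a, S.toA i b] ∈ C ∧
      (¬ S.f i ^ (k + 1) ∣ a ∨ ¬ S.f i ^ (k + 1) ∣ b) := by
    rcases hkN.lt_or_eq with hlt | heq
    · have h := Nat.findGreatest_is_greatest (P := P) (n := N) (k := k + 1) (by omega) (by omega)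
      by_contra hcon
      refine h fun a b hab => ?_
      by_contra h2
      exact hcon ⟨a, b, hab, not_and_or.1 h2⟩
    · -- for the zero code, the representative `f_i^{2^λ}` of `0` is not divisible by `f_i^{k+1}`
      refine ⟨S.f i ^ N, 0, ?_, Or.inl ?_⟩
      · convert C.zero_mem using 1
        rw [hN, S.toA_eq_zero_iff.2 dvd_rfl, map_zero]
        ext t
        fin_cases t <;> rfl
      · rw [heq, pow_dvd_pow_iff (S.f_ne_zero i) (S.f_prime i).not_isUnit]
        omega
  -- the second alternative is used only if no first coordinate attains the exponent `k`;
  -- this forces `f_i ∣ c` and `j ≥ 1`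
  by_cases hA : ∃ a b, ![S.toA i a, S.toA i b] ∈ C ∧ ¬ S.f i ^ (k + 1) ∣ a
  · left
    obtain ⟨a, b, hab, ha⟩ := hA
    obtain ⟨j, c, hkj, rfl⟩ := S.exists_eq_normalCode hPk hab ha
    obtain ⟨c', hc', hcc'⟩ := S.exists_mem_degreeLT_dvd_sub i j c
    exact ⟨k, j, c', hkj, hc', S.normalCode_congr hkj hcc'⟩
  · right
    push Not at hA
    obtain ⟨a, b, hab, h⟩ := hex
    have hb : ¬ S.f i ^ (k + 1) ∣ b := h.resolve_left (fun h => h (hA a b hab))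
    obtain ⟨j, c, hkj, hD⟩ := S.exists_eq_normalCode (C := S.swapCode C)
      (fun x y h => (hPk y x (S.mem_swapCode.1 h)).symm) (S.mem_swapCode.2 hab) hb
    have hA' : ∀ x y, ![S.toA i x, S.toA i y] ∈ S.normalCode i k j c → S.f i ^ (k + 1) ∣ y := by
      intro x y hxy
      rw [← hD, S.mem_swapCode] at hxy
      exact hA y x hxy
    have hpk : S.f i ^ k ≠ 0 := pow_ne_zero _ (S.f_ne_zero i)
    have hc : S.f i ∣ c := by
      have h := hA' (S.f i ^ k) (S.f i ^ k * c)
        ((S.mem_normalCode hkj).2 ⟨dvd_rfl, ⟨0, by ring⟩⟩)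
      rw [pow_succ] at h
      exact (mul_dvd_mul_iff_left hpk).1 h
    have hj : 1 ≤ j := by
      have h := hA' 0 (S.f i ^ (k + j)) ((S.mem_normalCode hkj).2 ⟨dvd_zero _, ⟨1, by ring⟩⟩)
      rw [pow_dvd_pow_iff (S.f_ne_zero i) (S.f_prime i).not_isUnit] at h
      omega
    obtain ⟨j, rfl⟩ := Nat.exists_eq_add_of_le' hj
    obtain ⟨b', rfl⟩ := hc
    obtain ⟨b'', hb'', hbb⟩ := S.exists_mem_degreeLT_dvd_sub i j b'
    refine ⟨k, j, b'', hkj, hb'', ?_⟩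
    rw [← S.swapCode_swapCode C, hD]
    refine congrArg _ (S.normalCode_congr hkj ?_)
    rw [← mul_sub, pow_succ']
    exact mul_dvd_mul_left _ hbb

theorem normalCode_injective {i : S.Index} {k j k' j' : ℕ} {c c' : (ZMod 2)[X]}
    (hkj : k + j ≤ 2 ^ S.lam) (hkj' : k' + j' ≤ 2 ^ S.lam)
    (h : S.normalCode i k j c = S.normalCode i k' j' c') :
    k = k' ∧ j = j' ∧ S.f i ^ j ∣ c - c' := by
  have key : ∀ {k j k' j' : ℕ} {c c' : (ZMod 2)[X]} (hkj : k + j ≤ 2 ^ S.lam)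
      (hkj' : k' + j' ≤ 2 ^ S.lam) (h : S.normalCode i k j c = S.normalCode i k' j' c'),
      k' ≤ k ∧ k' + j' ≤ k + j ∧ S.f i ^ (k' + j') ∣ S.f i ^ k * (c - c') := by
    intro k j k' j' c c' hkj hkj' h
    have h1 : ![S.toA i (S.f i ^ k), S.toA i (S.f i ^ k * c)] ∈ S.normalCode i k j c :=
      (S.mem_normalCode hkj).2 ⟨dvd_rfl, ⟨0, by ring⟩⟩
    have h2 : ![S.toA i 0, S.toA i (S.f i ^ (k + j))] ∈ S.normalCode i k j c :=
      (S.mem_normalCode hkj).2 ⟨dvd_zero _, ⟨1, by ring⟩⟩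
    rw [h, S.mem_normalCode hkj'] at h1 h2
    rw [mul_zero, sub_zero, pow_dvd_pow_iff (S.f_ne_zero i) (S.f_prime i).not_isUnit] at h2
    rw [pow_dvd_pow_iff (S.f_ne_zero i) (S.f_prime i).not_isUnit, mul_comm c', ← mul_sub] at h1
    exact ⟨h1.1, h2.2, h1.2⟩
  obtain ⟨h1, h2, h3⟩ := key hkj hkj' h
  obtain ⟨h4, h5, -⟩ := key hkj' hkj h.symm
  obtain rfl : k = k' := by omega
  obtain rfl : j = j' := by omega
  rw [pow_add, mul_dvd_mul_iff_left (pow_ne_zero _ (S.f_ne_zero i))] at h3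
  exact ⟨rfl, rfl, h3⟩

/-- The two kinds of normal forms are disjoint: `1 - f_i b c` is prime to `f_i`. -/
theorem normalCode_ne_swapCode {i : S.Index} {k j k' j' : ℕ} {c b : (ZMod 2)[X]}
    (hkj : k + j ≤ 2 ^ S.lam) (hkj' : k' + (j' + 1) ≤ 2 ^ S.lam) :
    S.normalCode i k j c ≠ S.swapCode (S.normalCode i k' (j' + 1) (S.f i * b)) := by
  intro h
  have h1 : ![S.toA i (S.f i ^ k), S.toA i (S.f i ^ k * c)] ∈ S.normalCode i k j c :=
    (S.mem_normalCode hkj).2 ⟨dvd_rfl, ⟨0, by ring⟩⟩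
  have h2 : ![S.toA i (S.f i ^ k' * (S.f i * b)), S.toA i (S.f i ^ k')] ∈
      S.swapCode (S.normalCode i k' (j' + 1) (S.f i * b)) :=
    S.mem_swapCode.2 ((S.mem_normalCode hkj').2 ⟨dvd_rfl, ⟨0, by ring⟩⟩)
  rw [← h, S.mem_normalCode hkj] at h2
  rw [h, S.mem_swapCode, S.mem_normalCode hkj'] at h1
  have hk : k ≤ k' := by
    have h3 := (dvd_sub_left (Dvd.dvd.mul_left h2.1 c)).1
      ((pow_dvd_pow _ (Nat.le_add_right k j)).trans h2.2)
    exact (pow_dvd_pow_iff (S.f_ne_zero i) (S.f_prime i).not_isUnit).1 h3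
  have h4 : S.f i ^ (k' + 1) ∣ S.f i ^ k * (1 - S.f i * b * c) := by
    refine (pow_dvd_pow _ (by omega : k' + 1 ≤ k' + (j' + 1))).trans ?_
    convert h1.2 using 1
    ring
  have h5 : ¬ S.f i ∣ 1 - S.f i * b * c := by
    intro h
    have h6 : S.f i ∣ S.f i * b * c := ⟨b * c, by ring⟩
    exact (S.f_prime i).not_isUnit (isUnit_of_dvd_one ((dvd_sub_left h6).1 h))
  have h6 := ((S.isCoprime_f_pow h5 _).symm).dvd_of_dvd_mul_right h4
  rw [pow_dvd_pow_iff (S.f_ne_zero i) (S.f_prime i).not_isUnit] at h6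
  omega

instance (n : ℕ) : Finite (Polynomial.degreeLT (ZMod 2) n) :=
  Finite.of_equiv _ (Polynomial.degreeLTEquiv (ZMod 2) n).toEquiv.symm

theorem card_degreeLT (n : ℕ) : Nat.card (Polynomial.degreeLT (ZMod 2) n) = 2 ^ n := by
  rw [Nat.card_congr (Polynomial.degreeLTEquiv (ZMod 2) n).toEquiv, Nat.card_fun]
  simp

/-- `f_i^k (A_i (1, c) + f_i^j A_i²)` is the image of `f_i^k A_i × f_i^{k+j} A_i` under the
shear `(a, b) ↦ (a, b + c a)`. -/
theorem card_normalCode {i : S.Index} {k j : ℕ} (hkj : k + j ≤ 2 ^ S.lam) (c : (ZMod 2)[X]) :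
    Nat.card (S.normalCode i k j c) =
      2 ^ ((2 ^ S.lam - k) * S.d i) * 2 ^ ((2 ^ S.lam - (k + j)) * S.d i) := by
  have hp : ∀ {s : ℕ}, s ≤ 2 ^ S.lam → ∀ {z : (ZMod 2)[X]},
      S.f i ^ 2 ^ S.lam ∣ S.f i ^ s * z ↔ S.f i ^ (2 ^ S.lam - s) ∣ z := by
    intro s hs z
    have h : S.f i ^ 2 ^ S.lam = S.f i ^ s * S.f i ^ (2 ^ S.lam - s) := by
      rw [← pow_add, Nat.add_sub_cancel' hs]
    rw [h]
    exact mul_dvd_mul_iff_left (pow_ne_zero _ (S.f_ne_zero i))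
  rw [← card_degreeLT ((2 ^ S.lam - k) * S.d i),
    ← card_degreeLT ((2 ^ S.lam - (k + j)) * S.d i), ← Nat.card_prod]
  symm
  refine Nat.card_congr (Equiv.ofBijective
    (fun xy => ⟨![S.toA i (S.f i ^ k * xy.1.1),
      S.toA i (S.f i ^ (k + j) * xy.2.1 + c * (S.f i ^ k * xy.1.1))],
      (S.mem_normalCode hkj).2 ⟨Dvd.intro _ rfl, ⟨xy.2.1, by ring⟩⟩⟩) ⟨?_, ?_⟩)
  · rintro ⟨⟨x, hx⟩, ⟨y, hy⟩⟩ ⟨⟨x', hx'⟩, ⟨y', hy'⟩⟩ h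
    obtain ⟨h1, h2⟩ := S.toA_vec_eq_iff.1 (congrArg Subtype.val h)
    rw [← mul_sub, hp (by omega)] at h1
    obtain rfl := S.degreeLT_eq_of_dvd_sub hx hx' h1
    rw [add_sub_add_right_eq_sub, ← mul_sub, hp hkj] at h2
    obtain rfl := S.degreeLT_eq_of_dvd_sub hy hy' h2
    rfl
  · rintro ⟨w, hw⟩
    obtain ⟨a, b, rfl⟩ := S.exists_eq_toA w
    obtain ⟨⟨x, rfl⟩, ⟨y, hy⟩⟩ := (S.mem_normalCode hkj).1 hw
    obtain ⟨x', hx', hxx⟩ := S.exists_mem_degreeLT_dvd_sub i (2 ^ S.lam - k) x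
    obtain ⟨y', hy', hyy⟩ := S.exists_mem_degreeLT_dvd_sub i (2 ^ S.lam - (k + j)) y
    refine ⟨⟨⟨x', hx'⟩, ⟨y', hy'⟩⟩, Subtype.ext (S.toA_vec_eq_iff.2 ?_)⟩
    obtain ⟨u, hu⟩ := (hp (by omega)).2 hxx
    obtain ⟨v, hv⟩ := (hp hkj).2 hyy
    exact ⟨⟨-u, by linear_combination -hu⟩, ⟨-v - c * u, by linear_combination -hv - c * hu - hy⟩⟩

/-! ### Codes stable under `(a, b) ↦ (b(x⁻¹), a(x⁻¹))` -/

/-- A code over `A_i`, with `f_i` self-reciprocal, is stable under `(a, b) ↦ (b(x⁻¹), a(x⁻¹))`. -/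
def IsBarStable (i : Fin (S.ρ + 1)) (C : S.LinearCode (Sum.inl i)) : Prop :=
  ∀ a b, ![S.toA (Sum.inl i) a, S.toA (Sum.inl i) b] ∈ C →
    ![S.toA (Sum.inl i) (polyBar m b), S.toA (Sum.inl i) (polyBar m a)] ∈ C

theorem f_inl_pow_dvd_polyBar {i : Fin (S.ρ + 1)} {s : ℕ} {q : (ZMod 2)[X]}
    (h : S.f (Sum.inl i) ^ s ∣ q) : S.f (Sum.inl i) ^ s ∣ polyBar m q :=
  S.f_star_pow_dvd_polyBar (i := Sum.inl i) h

theorem f_inl_pow_dvd_of_dvd_polyBar_mul {i : Fin (S.ρ + 1)} {k j : ℕ}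
    (hkj : k + j ≤ 2 ^ S.lam) {z : (ZMod 2)[X]}
    (h : S.f (Sum.inl i) ^ (k + j) ∣ polyBar m (S.f (Sum.inl i)) ^ k * z) :
    S.f (Sum.inl i) ^ j ∣ z :=
  S.f_star_pow_dvd_of_dvd_polyBar_mul (i := Sum.inl i) hkj h

theorem isBarStable_normalCode_iff {i : Fin (S.ρ + 1)} {k j : ℕ} (hkj : k + j ≤ 2 ^ S.lam)
    (c : (ZMod 2)[X]) :
    S.IsBarStable i (S.normalCode (Sum.inl i) k j c) ↔
      S.f (Sum.inl i) ^ j ∣ c * polyBar m c - 1 := by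
  constructor
  · intro h
    have h1 := h (S.f (Sum.inl i) ^ k) (S.f (Sum.inl i) ^ k * c)
      ((S.mem_normalCode hkj).2 ⟨dvd_rfl, ⟨0, by ring⟩⟩)
    rw [S.mem_normalCode hkj] at h1
    have h2 : S.f (Sum.inl i) ^ j ∣ 1 - c * polyBar m c := by
      refine S.f_inl_pow_dvd_of_dvd_polyBar_mul hkj ?_
      convert h1.2 using 1
      rw [map_mul, map_pow]
      ring
    rwa [← neg_sub, dvd_neg]
  · intro h a b hab
    rw [S.mem_normalCode hkj] at hab ⊢
    obtain ⟨ha, hb⟩ := hab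
    have hkb : S.f (Sum.inl i) ^ k ∣ b :=
      (dvd_sub_left (ha.mul_left c)).1 ((pow_dvd_pow _ (Nat.le_add_right k j)).trans hb)
    refine ⟨S.f_inl_pow_dvd_polyBar hkb, ?_⟩
    have h0 := mul_dvd_mul (S.f_inl_pow_dvd_polyBar ha) h
    rw [← pow_add] at h0
    have h1 := dvd_add h0 ((S.f_inl_pow_dvd_polyBar hb).mul_left c)
    rw [← dvd_neg] at h1
    convert h1 using 1
    rw [map_sub, map_mul]
    ring

/-- Stability would force `f_i` to divide `1 - c(x) c(x⁻¹)`, whereas `f_i ∣ c`. -/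
theorem not_isBarStable_swapCode {i : Fin (S.ρ + 1)} {k j : ℕ} {b : (ZMod 2)[X]}
    (hkj : k + (j + 1) ≤ 2 ^ S.lam) :
    ¬ S.IsBarStable i
      (S.swapCode (S.normalCode (Sum.inl i) k (j + 1) (S.f (Sum.inl i) * b))) := by
  intro h
  have h1 := h _ _ (S.mem_swapCode.2 ((S.mem_normalCode hkj).2
    ⟨dvd_refl (S.f (Sum.inl i) ^ k),
      (⟨0, by ring⟩ : _ ∣ S.f (Sum.inl i) ^ k * (S.f (Sum.inl i) * b) - _)⟩))
  rw [mem_swapCode, S.mem_normalCode hkj] at h1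
  have h2 : S.f (Sum.inl i) ^ (j + 1) ∣
      1 - S.f (Sum.inl i) * b * polyBar m (S.f (Sum.inl i) * b) := by
    refine S.f_inl_pow_dvd_of_dvd_polyBar_mul hkj ?_
    convert h1.2 using 1
    rw [map_mul (polyBar m) (S.f (Sum.inl i) ^ k), map_pow]
    ring
  have h3 := (dvd_pow_self (S.f (Sum.inl i)) j.succ_ne_zero).trans h2
  rw [mul_assoc, dvd_sub_left (Dvd.intro _ rfl)] at h3
  exact (S.f_prime _).not_isUnit (isUnit_of_dvd_one h3)

/-! ### The numbers of codes -/

/-- The codes are counted by their normal forms; the exponent `k` ranges over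
`0, …, 2^λ - j` in the first kind and over `0, …, 2^λ - j - 1` in the second, where the exponent
`j + 1` and the multiplier `f_i b` occur. -/
theorem card_linearCode (i : S.Index) : Nat.card (S.LinearCode i) = S.numLinear i := by
  obtain ⟨N, hN⟩ : ∃ N, N = 2 ^ S.lam := ⟨_, rfl⟩
  let T : Type := (Σ j : Fin (N + 1), Fin (N + 1 - j) × Polynomial.degreeLT (ZMod 2) (j * S.d i)) ⊕
    (Σ j : Fin N, Fin (N - j) × Polynomial.degreeLT (ZMod 2) (j * S.d i))
  let Φ : T → S.LinearCode i := Sum.elim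
    (fun t => S.normalCode i t.2.1 t.1 t.2.2)
    (fun t => S.swapCode (S.normalCode i t.2.1 (t.1 + 1) (S.f i * t.2.2)))
  have hΦ : Function.Bijective Φ := by
    constructor
    · rintro (⟨⟨j, hj⟩, ⟨k, hk⟩, ⟨c, hc⟩⟩ | ⟨⟨j, hj⟩, ⟨k, hk⟩, ⟨c, hc⟩⟩)
        (⟨⟨j', hj'⟩, ⟨k', hk'⟩, ⟨c', hc'⟩⟩ | ⟨⟨j', hj'⟩, ⟨k', hk'⟩, ⟨c', hc'⟩⟩) h
      · obtain ⟨rfl, rfl, h3⟩ := S.normalCode_injective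
          (by rw [← hN]; dsimp only at hk ⊢; omega) (by rw [← hN]; dsimp only at hk' ⊢; omega) h
        obtain rfl := S.degreeLT_eq_of_dvd_sub hc hc' h3
        rfl
      · exact absurd h (S.normalCode_ne_swapCode
          (by rw [← hN]; dsimp only at hk ⊢; omega) (by rw [← hN]; dsimp only at hk' ⊢; omega))
      · exact absurd h.symm (S.normalCode_ne_swapCode
          (by rw [← hN]; dsimp only at hk' ⊢; omega) (by rw [← hN]; dsimp only at hk ⊢; omega))
      · obtain ⟨h1, h2, h3⟩ := S.normalCode_injective
          (by rw [← hN]; dsimp only at hk ⊢; omega) (by rw [← hN]; dsimp only at hk' ⊢; omega)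
          (S.swapCode_injective i h)
        dsimp only at h1 h2 h3
        obtain rfl := h1
        obtain rfl : j = j' := by omega
        rw [← mul_sub, pow_succ', mul_dvd_mul_iff_left (S.f_ne_zero i)] at h3
        obtain rfl := S.degreeLT_eq_of_dvd_sub hc hc' h3
        rfl
    · intro C
      rcases S.exists_normalForm C with ⟨k, j, c, hkj, hc, rfl⟩ | ⟨k, j, b, hkj, hb, rfl⟩
      · exact ⟨Sum.inl ⟨⟨j, by omega⟩, ⟨k, by dsimp only; omega⟩, ⟨c, hc⟩⟩, rfl⟩
      · exact ⟨Sum.inr ⟨⟨j, by omega⟩, ⟨k, by dsimp only; omega⟩, ⟨b, hb⟩⟩, rfl⟩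
  rw [← Nat.card_congr (Equiv.ofBijective Φ hΦ), Nat.card_sum, Nat.card_sigma, Nat.card_sigma]
  simp only [Nat.card_prod, Nat.card_eq_fintype_card, Fintype.card_fin]
  simp only [card_degreeLT]
  rw [Fin.sum_univ_eq_sum_range (fun j => (N + 1 - j) * 2 ^ (j * S.d i)),
    Fin.sum_univ_eq_sum_range (fun j => (N - j) * 2 ^ (j * S.d i)), numLinear, ← hN,
    ← Nat.range_succ_eq_Icc_zero]
  have h : ∑ j ∈ Finset.range N, (N - j) * 2 ^ (j * S.d i) =
      ∑ j ∈ Finset.range (N + 1), (N - j) * 2 ^ (j * S.d i) := by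
    rw [Finset.sum_range_succ, Nat.sub_self, zero_mul, add_zero]
  rw [h, ← Finset.sum_add_distrib,
    ← Finset.sum_range_reflect (fun k => (2 * k + 1) * 2 ^ ((N - k) * S.d i))]
  refine Finset.sum_congr rfl fun j hj => ?_
  have hj := Finset.mem_range.1 hj
  rw [← add_mul, show N + 1 - 1 - j = N - j by omega, show N - (N - j) = j by omega,
    show N + 1 - j + (N - j) = 2 * (N - j) + 1 by omega]

theorem W_zero (i : S.Index) : S.W i 0 = {0} := by
  ext w
  simp only [W, Set.mem_ofPred_eq, Polynomial.mem_degreeLT, zero_mul, pow_zero, isUnit_one,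
    IsUnit.dvd, and_true, Set.mem_singleton_iff, Nat.cast_zero]
  rw [← Polynomial.degree_eq_bot, Nat.WithBot.lt_zero_iff]

theorem finite_W (i : S.Index) (s : ℕ) : (S.W i s).Finite :=
  have h : Finite (Polynomial.degreeLT (ZMod 2) (s * S.d i)) := inferInstance
  Set.Finite.subset (Set.finite_coe_iff.1 h) fun _ h => h.1

/-- A stable code is `f_i^k (A_i (1, c) + f_i^j A_i²)` with `c(x) c(x⁻¹) ≡ 1` modulo `f_i^j`. -/
theorem IsBarStable.exists_normalForm {S : DihedralSetup m} {i : Fin (S.ρ + 1)}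
    {C : S.LinearCode (Sum.inl i)} (hC : S.IsBarStable i C) :
    ∃ k j c, k + j ≤ 2 ^ S.lam ∧ c ∈ S.W (Sum.inl i) j ∧ C = S.normalCode (Sum.inl i) k j c := by
  rcases S.exists_normalForm C with ⟨k, j, c, hkj, hc, rfl⟩ | ⟨k, j, b, hkj, hb, rfl⟩
  · exact ⟨k, j, c, hkj, ⟨hc, (S.isBarStable_normalCode_iff hkj c).1 hC⟩, rfl⟩
  · exact absurd hC (S.not_isBarStable_swapCode hkj)

theorem card_isBarStable (i : Fin (S.ρ + 1)) :
    Nat.card {C // S.IsBarStable i C} = S.numSymmetric i := by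
  obtain ⟨N, hN⟩ : ∃ N, N = 2 ^ S.lam := ⟨_, rfl⟩
  let T : Type := Σ j : Fin (N + 1), Fin (N + 1 - j) × S.W (Sum.inl i) j
  have hle : ∀ t : T, (t.2.1 : ℕ) + t.1 ≤ 2 ^ S.lam := by
    rintro ⟨⟨j, hj⟩, ⟨k, hk⟩, c⟩
    rw [← hN]
    dsimp only at hk ⊢
    omega
  let Φ : T → {C // S.IsBarStable i C} := fun t =>
    ⟨S.normalCode (Sum.inl i) t.2.1 t.1 t.2.2,
      (S.isBarStable_normalCode_iff (hle t) _).2 t.2.2.2.2⟩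
  have hΦ : Function.Bijective Φ := by
    constructor
    · intro t t' h
      have h0 := S.normalCode_injective (hle t) (hle t') (congrArg Subtype.val h)
      obtain ⟨⟨j, hj⟩, ⟨k, hk⟩, ⟨c, hc⟩⟩ := t
      obtain ⟨⟨j', hj'⟩, ⟨k', hk'⟩, ⟨c', hc'⟩⟩ := t'
      obtain ⟨rfl, rfl, h3⟩ := h0
      obtain rfl := S.degreeLT_eq_of_dvd_sub hc.1 hc'.1 h3
      rfl
    · rintro ⟨C, hC⟩
      obtain ⟨k, j, c, hkj, hc, rfl⟩ := hC.exists_normalForm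
      exact ⟨⟨⟨j, by omega⟩, ⟨k, by dsimp only; omega⟩, ⟨c, hc⟩⟩, rfl⟩
  have hfin : ∀ j, Finite (S.W (Sum.inl i) j) := fun j => (S.finite_W _ j).to_subtype
  rw [← Nat.card_congr (Equiv.ofBijective Φ hΦ), Nat.card_sigma]
  simp only [Nat.card_prod, Nat.card_fin, Nat.card_coe_set_eq]
  rw [Fin.sum_univ_eq_sum_range (fun j => (N + 1 - j) * (S.W (Sum.inl i) j).ncard),
    Finset.sum_range_succ', numSymmetric, ← hN, W_zero, Set.ncard_singleton,
    show Finset.Icc 1 N = Finset.Ico 1 (N + 1) from rfl, Finset.sum_Ico_eq_sum_range,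
    Nat.add_sub_cancel, add_comm, Nat.sub_zero, mul_one, add_comm N 1]
  congr 1
  refine Finset.sum_congr rfl fun j hj => ?_
  have hj := Finset.mem_range.1 hj
  rw [add_comm 1 j]
  congr 1
  omega

/-! ### Generator matrices -/

theorem span_range_row_one {i : S.Index} (a b : S.A i) :
    Submodule.span (S.A i) (Set.range (!![a, b] : Matrix (Fin 1) (Fin 2) (S.A i)).row) =
      Submodule.span (S.A i) {![a, b]} := by
  congr 1
  ext w
  constructor
  · rintro ⟨t, rfl⟩
    fin_cases t
    rfl
  · rintro rfl
    exact ⟨0, rfl⟩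

theorem span_range_row_two {i : S.Index} (a b c d : S.A i) :
    Submodule.span (S.A i) (Set.range (!![a, b; c, d] : Matrix (Fin 2) (Fin 2) (S.A i)).row) =
      Submodule.span (S.A i) {![a, b], ![c, d]} := by
  congr 1
  ext w
  constructor
  · rintro ⟨t, rfl⟩
    fin_cases t
    · exact Or.inl rfl
    · exact Or.inr rfl
  · rintro (rfl | rfl)
    · exact ⟨0, rfl⟩
    · exact ⟨1, rfl⟩

theorem isGeneratorMatrix_one {i : S.Index} {a b : S.A i} {C : S.LinearCode i}
    (h : ![a, b] ≠ 0) (hC : Submodule.span (S.A i) {![a, b]} = C) :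
    S.IsGeneratorMatrix !![a, b] C := by
  refine ⟨by rw [span_range_row_one, hC], fun _ j => ?_⟩
  have hj : ({j}ᶜ : Set (Fin 1)) = ∅ := by
    ext t
    simp [Subsingleton.elim t j]
  rw [hj, Set.image_empty, Submodule.span_empty, Submodule.mem_bot, Subsingleton.elim j 0]
  exact h

theorem isGeneratorMatrix_two {i : S.Index} {a b c d : S.A i} {C : S.LinearCode i}
    (h1 : ![a, b] ∉ Submodule.span (S.A i) {![c, d]})
    (h2 : ![c, d] ∉ Submodule.span (S.A i) {![a, b]})
    (hC : Submodule.span (S.A i) {![a, b], ![c, d]} = C) :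
    S.IsGeneratorMatrix !![a, b; c, d] C := by
  refine ⟨by rw [span_range_row_two, hC], fun _ j => ?_⟩
  have h0 : ({0}ᶜ : Set (Fin 2)) = {1} := by ext t; fin_cases t <;> simp
  have h0' : ({1}ᶜ : Set (Fin 2)) = {0} := by ext t; fin_cases t <;> simp
  fin_cases j
  · simp only [Fin.zero_eta, h0, Set.image_singleton]
    exact h1
  · simp only [Fin.mk_one, h0', Set.image_singleton]
    exact h2

/-- For the zero code the rows need not be independent. -/
theorem isGeneratorMatrix_bot {i : S.Index} {a b c d : S.A i}
    (hC : Submodule.span (S.A i) {![a, b], ![c, d]} = ⊥) :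
    S.IsGeneratorMatrix !![a, b; c, d] ⊥ :=
  ⟨by rw [span_range_row_two, hC], fun h => absurd rfl h⟩

theorem toA_f_pow_eq_zero_iff {i : S.Index} {s : ℕ} :
    S.toA i (S.f i ^ s) = 0 ↔ 2 ^ S.lam ≤ s := by
  rw [toA_eq_zero_iff, pow_dvd_pow_iff (S.f_ne_zero i) (S.f_prime i).not_isUnit]

/-- If `k + j = 2^λ`, the second generator of `normalCode` vanishes. -/
theorem isGeneratorMatrix_normalCode_one {i : S.Index} {k j : ℕ} (hkj : k + j = 2 ^ S.lam)
    (hj : 1 ≤ j) (c : (ZMod 2)[X]) :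
    S.IsGeneratorMatrix !![S.toA i (S.f i ^ k), S.toA i (S.f i ^ k * c)]
      (S.normalCode i k j c) := by
  refine S.isGeneratorMatrix_one (fun h => ?_) ?_
  · have h1 := S.toA_f_pow_eq_zero_iff.1 (congrFun h 0)
    omega
  · rw [normalCode, hkj, S.toA_eq_zero_iff.2 dvd_rfl, Set.pair_comm]
    have h0 : (![0, 0] : Fin 2 → S.A i) = 0 := by ext t; fin_cases t <;> rfl
    rw [h0, Submodule.span_insert_zero]

theorem isGeneratorMatrix_swapCode_one {i : S.Index} {k j : ℕ} (hkj : k + j = 2 ^ S.lam)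
    (hj : 1 ≤ j) (c : (ZMod 2)[X]) :
    S.IsGeneratorMatrix !![S.toA i (S.f i ^ k * c), S.toA i (S.f i ^ k)]
      (S.swapCode (S.normalCode i k j c)) := by
  refine S.isGeneratorMatrix_one (fun h => ?_) ?_
  · have h1 := S.toA_f_pow_eq_zero_iff.1 (congrFun h 1)
    omega
  · rw [swapCode_normalCode, hkj, S.toA_eq_zero_iff.2 dvd_rfl, Set.pair_comm]
    have h0 : (![0, 0] : Fin 2 → S.A i) = 0 := by ext t; fin_cases t <;> rfl
    rw [h0, Submodule.span_insert_zero]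

theorem isGeneratorMatrix_normalCode_two {i : S.Index} {k j : ℕ} (hkj : k + j < 2 ^ S.lam)
    (c : (ZMod 2)[X]) :
    S.IsGeneratorMatrix !![S.toA i (S.f i ^ k), S.toA i (S.f i ^ k * c);
      0, S.toA i (S.f i ^ (k + j))] (S.normalCode i k j c) := by
  refine S.isGeneratorMatrix_two (fun h => ?_) (fun h => ?_) rfl
  · obtain ⟨x, hx⟩ := Submodule.mem_span_singleton.1 h
    have h1 : x * 0 = S.toA i (S.f i ^ k) := congrFun hx 0
    have h2 := S.toA_f_pow_eq_zero_iff.1 (h1.symm.trans (mul_zero x))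
    omega
  · obtain ⟨x, hx⟩ := Submodule.mem_span_singleton.1 h
    have h1 : x * S.toA i (S.f i ^ k) = 0 := congrFun hx 0
    have h2 : x * S.toA i (S.f i ^ k * c) = S.toA i (S.f i ^ (k + j)) := congrFun hx 1
    rw [map_mul, ← mul_assoc, h1, zero_mul] at h2
    have h3 := S.toA_f_pow_eq_zero_iff.1 h2.symm
    omega

theorem isGeneratorMatrix_swapCode_two {i : S.Index} {k j : ℕ} (hkj : k + j < 2 ^ S.lam)
    (c : (ZMod 2)[X]) :
    S.IsGeneratorMatrix !![S.toA i (S.f i ^ k * c), S.toA i (S.f i ^ k);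
      S.toA i (S.f i ^ (k + j)), 0] (S.swapCode (S.normalCode i k j c)) := by
  refine S.isGeneratorMatrix_two (fun h => ?_) (fun h => ?_) (S.swapCode_normalCode k j c).symm
  · obtain ⟨x, hx⟩ := Submodule.mem_span_singleton.1 h
    have h1 : x * 0 = S.toA i (S.f i ^ k) := congrFun hx 1
    have h2 := S.toA_f_pow_eq_zero_iff.1 (h1.symm.trans (mul_zero x))
    omega
  · obtain ⟨x, hx⟩ := Submodule.mem_span_singleton.1 h
    have h1 : x * S.toA i (S.f i ^ k) = 0 := congrFun hx 1
    have h2 : x * S.toA i (S.f i ^ k * c) = S.toA i (S.f i ^ (k + j)) := congrFun hx 0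
    rw [map_mul, ← mul_assoc, h1, zero_mul] at h2
    have h3 := S.toA_f_pow_eq_zero_iff.1 h2.symm
    omega

theorem isGeneratorMatrix_normalCode_scalar {i : S.Index} {k : ℕ} (hk : k ≤ 2 ^ S.lam) :
    S.IsGeneratorMatrix !![S.toA i (S.f i ^ k), 0; 0, S.toA i (S.f i ^ k)]
      (S.normalCode i k 0 0) := by
  have hspan : Submodule.span (S.A i) {![S.toA i (S.f i ^ k), 0], ![0, S.toA i (S.f i ^ k)]} =
      S.normalCode i k 0 0 := by
    rw [normalCode, mul_zero, map_zero, add_zero]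
  rcases hk.lt_or_eq with hk | hk
  · have h := S.isGeneratorMatrix_normalCode_two (i := i) (k := k) (j := 0) hk 0
    rwa [mul_zero, map_zero, add_zero] at h
  · have hbot : S.normalCode i k 0 0 = ⊥ := by
      rw [← hspan, S.toA_f_pow_eq_zero_iff.2 hk.ge, Submodule.span_eq_bot]
      intro w hw
      rcases hw with rfl | rfl <;> (ext t; fin_cases t <;> rfl)
    rw [hbot] at hspan ⊢
    exact S.isGeneratorMatrix_bot hspan

theorem eq_zero_of_mem_degreeLT_zero {c : (ZMod 2)[X]} {n : ℕ}
    (hc : c ∈ Polynomial.degreeLT (ZMod 2) (0 * n)) : c = 0 := by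
  rw [zero_mul, Polynomial.mem_degreeLT, Nat.cast_zero, Nat.WithBot.lt_zero_iff] at hc
  exact Polynomial.degree_eq_bot.1 hc

theorem exists_isSymmetric {i : Fin (S.ρ + 1)} {k j : ℕ} {c : (ZMod 2)[X]}
    (hkj : k + j ≤ 2 ^ S.lam) (hc : c ∈ S.W (Sum.inl i) j) :
    ∃ (n : ℕ) (G : Matrix (Fin n) (Fin 2) (S.A (Sum.inl i))),
      S.IsSymmetric i G ∧ S.IsGeneratorMatrix G (S.normalCode (Sum.inl i) k j c) := by
  rcases Nat.eq_zero_or_pos j with rfl | hj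
  · obtain rfl : c = 0 := eq_zero_of_mem_degreeLT_zero hc.1
    exact ⟨_, _, .caseIII k hkj, S.isGeneratorMatrix_normalCode_scalar hkj⟩
  rcases hkj.lt_or_eq with hlt | heq
  · have hG := S.isGeneratorMatrix_normalCode_two (i := Sum.inl i) hlt c
    rcases Nat.eq_zero_or_pos k with rfl | hk
    · rw [zero_add, pow_zero, one_mul, map_one] at hG
      exact ⟨_, _, .caseIV j hj (by omega) c hc, hG⟩
    · exact ⟨_, _, .caseV k j hk (by omega) hj (by omega) c hc, hG⟩
  · have hG := S.isGeneratorMatrix_normalCode_one (i := Sum.inl i) heq hj c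
    rcases Nat.eq_zero_or_pos k with rfl | hk
    · rw [pow_zero, one_mul, map_one] at hG
      rw [zero_add] at heq
      exact ⟨_, _, .caseI c (heq ▸ hc), hG⟩
    · have hj' : j = 2 ^ S.lam - k := by omega
      exact ⟨_, _, .caseII k hk (by omega) c (hj' ▸ hc), hG⟩

theorem exists_isStandard {i : S.Index} (C : S.LinearCode i) :
    ∃ (n : ℕ) (G : Matrix (Fin n) (Fin 2) (S.A i)),
      S.IsStandard i G ∧ S.IsGeneratorMatrix G C := by
  rcases S.exists_normalForm C with ⟨k, j, c, hkj, hc, rfl⟩ | ⟨k, j, b, hkj, hb, rfl⟩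
  · rcases Nat.eq_zero_or_pos j with rfl | hj
    · obtain rfl : c = 0 := eq_zero_of_mem_degreeLT_zero hc
      exact ⟨_, _, .case5 k hkj, S.isGeneratorMatrix_normalCode_scalar hkj⟩
    rcases hkj.lt_or_eq with hlt | heq
    · have hG := S.isGeneratorMatrix_normalCode_two (i := i) hlt c
      rcases Nat.eq_zero_or_pos k with rfl | hk
      · rw [zero_add, pow_zero, one_mul, map_one] at hG
        exact ⟨_, _, .case6 j hj (by omega) c hc, hG⟩
      · exact ⟨_, _, .case7 k j hk (by omega) hj (by omega) c hc, hG⟩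
    · have hG := S.isGeneratorMatrix_normalCode_one (i := i) heq hj c
      rcases Nat.eq_zero_or_pos k with rfl | hk
      · rw [pow_zero, one_mul, map_one] at hG
        rw [zero_add] at heq
        exact ⟨_, _, .case1 c (heq ▸ hc), hG⟩
      · have hj' : j = 2 ^ S.lam - k := by omega
        exact ⟨_, _, .case2 k hk (by omega) c (hj' ▸ hc), hG⟩
  · rcases hkj.lt_or_eq with hlt | heq
    · have hG := S.isGeneratorMatrix_swapCode_two (i := i) hlt (S.f i * b)
      have hc : S.f i * b ∈ Polynomial.degreeLT (ZMod 2) ((j + 1) * S.d i) := by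
        rcases eq_or_ne b 0 with rfl | hb0
        · rw [mul_zero]; exact Submodule.zero_mem _
        · rw [Polynomial.mem_degreeLT, Polynomial.degree_eq_natDegree hb0, Nat.cast_lt] at hb
          rw [Polynomial.mem_degreeLT,
            Polynomial.degree_eq_natDegree (mul_ne_zero (S.f_ne_zero i) hb0), Nat.cast_lt,
            Polynomial.natDegree_mul (S.f_ne_zero i) hb0, add_mul, one_mul, add_comm]
          exact Nat.add_lt_add_right hb _
      rcases Nat.eq_zero_or_pos k with rfl | hk
      · rw [zero_add, pow_zero, one_mul, map_one] at hG
        exact ⟨_, _, .case8 (j + 1) (by omega) (by omega) _ hc (Dvd.intro _ rfl), hG⟩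
      · exact ⟨_, _, .case9 k (j + 1) hk (by omega) (by omega) (by omega) _ hc
          (Dvd.intro _ rfl), hG⟩
    · have hG := S.isGeneratorMatrix_swapCode_one (i := i) heq (by omega) (S.f i * b)
      have hj' : j = 2 ^ S.lam - k - 1 := by omega
      rcases Nat.eq_zero_or_pos k with rfl | hk
      · rw [pow_zero, one_mul, map_one] at hG
        exact ⟨_, _, .case3 b (hj' ▸ hb), hG⟩
      · rw [← mul_assoc, ← pow_succ] at hG
        exact ⟨_, _, .case4 k hk (by omega) b (hj' ▸ hb), hG⟩

/-! ### Cardinalities from generator matrices -/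

theorem toA_f_pow_dvd_toA_iff {i : S.Index} {s : ℕ} (hs : s ≤ 2 ^ S.lam) {a : (ZMod 2)[X]} :
    S.toA i (S.f i ^ s) ∣ S.toA i a ↔ S.f i ^ s ∣ a := by
  constructor
  · rintro ⟨x, hx⟩
    obtain ⟨x, rfl⟩ := Ideal.Quotient.mk_surjective x
    rw [← map_mul, toA_eq_toA_iff] at hx
    exact (dvd_sub_left (Dvd.intro _ rfl)).1 ((pow_dvd_pow _ hs).trans hx)
  · exact map_dvd _

theorem fDegree_le (i : S.Index) (a : S.A i) : S.fDegree i a ≤ 2 ^ S.lam := by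
  classical exact Nat.findGreatest_le _

theorem le_fDegree {i : S.Index} {s : ℕ} (hs : s ≤ 2 ^ S.lam) {a : S.A i}
    (h : S.toA i (S.f i ^ s) ∣ a) : s ≤ S.fDegree i a := by
  classical exact Nat.le_findGreatest hs h

theorem fDegree_f_pow {i : S.Index} {s : ℕ} (hs : s ≤ 2 ^ S.lam) :
    S.fDegree i (S.toA i (S.f i ^ s)) = s := by
  classical
  refine le_antisymm ?_ (S.le_fDegree hs dvd_rfl)
  have h : S.toA i (S.f i ^ S.fDegree i (S.toA i (S.f i ^ s))) ∣ S.toA i (S.f i ^ s) :=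
    Nat.findGreatest_spec (P := fun j => S.toA i (S.f i ^ j) ∣ S.toA i (S.f i ^ s)) hs dvd_rfl
  rw [S.toA_f_pow_dvd_toA_iff (S.fDegree_le i _),
    pow_dvd_pow_iff (S.f_ne_zero i) (S.f_prime i).not_isUnit] at h
  exact h

theorem vecDegree_f_pow_left {i : S.Index} {s : ℕ} (hs : s ≤ 2 ^ S.lam) (c : (ZMod 2)[X]) :
    S.vecDegree i ![S.toA i (S.f i ^ s), S.toA i (S.f i ^ s * c)] = s := by
  refine (min_eq_left ?_).trans (S.fDegree_f_pow hs)
  refine (S.fDegree_f_pow hs).le.trans (S.le_fDegree hs ?_)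
  exact map_dvd _ (Dvd.intro _ rfl)

theorem vecDegree_f_pow_right {i : S.Index} {s : ℕ} (hs : s ≤ 2 ^ S.lam) (c : (ZMod 2)[X]) :
    S.vecDegree i ![S.toA i (S.f i ^ s * c), S.toA i (S.f i ^ s)] = s := by
  refine (min_comm _ _).trans ?_
  exact S.vecDegree_f_pow_left hs c

theorem vecDegree_zero_f_pow {i : S.Index} {s : ℕ} (hs : s ≤ 2 ^ S.lam) :
    S.vecDegree i ![0, S.toA i (S.f i ^ s)] = s := by
  have h := S.vecDegree_f_pow_right (i := i) hs 0
  rwa [mul_zero, map_zero] at h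

theorem vecDegree_f_pow_zero {i : S.Index} {s : ℕ} (hs : s ≤ 2 ^ S.lam) :
    S.vecDegree i ![S.toA i (S.f i ^ s), 0] = s := by
  have h := S.vecDegree_f_pow_left (i := i) hs 0
  rwa [mul_zero, map_zero] at h

theorem rowCount_one {i : S.Index} (a b : S.A i) :
    S.rowCount !![a, b] = 2 ^ ((2 ^ S.lam - S.vecDegree i ![a, b]) * S.d i) :=
  Fin.prod_univ_one _

theorem rowCount_two {i : S.Index} (a b c d : S.A i) :
    S.rowCount !![a, b; c, d] = 2 ^ ((2 ^ S.lam - S.vecDegree i ![a, b]) * S.d i) *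
      2 ^ ((2 ^ S.lam - S.vecDegree i ![c, d]) * S.d i) :=
  Fin.prod_univ_two _

theorem card_span_normal_one {i : S.Index} {k : ℕ} (hk : k < 2 ^ S.lam) (c : (ZMod 2)[X]) :
    Nat.card (Submodule.span (S.A i) (Set.range
      (!![S.toA i (S.f i ^ k), S.toA i (S.f i ^ k * c)] : Matrix (Fin 1) _ _).row)) =
      S.rowCount !![S.toA i (S.f i ^ k), S.toA i (S.f i ^ k * c)] := by
  rw [(S.isGeneratorMatrix_normalCode_one (Nat.add_sub_cancel' hk.le) (by omega) c).1,
    S.card_normalCode (by omega), S.rowCount_one, S.vecDegree_f_pow_left hk.le,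
    Nat.add_sub_cancel' hk.le, Nat.sub_self, zero_mul, pow_zero, mul_one]

theorem card_span_swap_one {i : S.Index} {k : ℕ} (hk : k < 2 ^ S.lam) (c : (ZMod 2)[X]) :
    Nat.card (Submodule.span (S.A i) (Set.range
      (!![S.toA i (S.f i ^ k * c), S.toA i (S.f i ^ k)] : Matrix (Fin 1) _ _).row)) =
      S.rowCount !![S.toA i (S.f i ^ k * c), S.toA i (S.f i ^ k)] := by
  rw [(S.isGeneratorMatrix_swapCode_one (Nat.add_sub_cancel' hk.le) (by omega) c).1,
    card_swapCode, S.card_normalCode (by omega), S.rowCount_one, S.vecDegree_f_pow_right hk.le,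
    Nat.add_sub_cancel' hk.le, Nat.sub_self, zero_mul, pow_zero, mul_one]

theorem card_span_normal_two {i : S.Index} {k j : ℕ} (hkj : k + j < 2 ^ S.lam)
    (c : (ZMod 2)[X]) :
    Nat.card (Submodule.span (S.A i) (Set.range
      (!![S.toA i (S.f i ^ k), S.toA i (S.f i ^ k * c); 0, S.toA i (S.f i ^ (k + j))] :
        Matrix (Fin 2) _ _).row)) =
      S.rowCount !![S.toA i (S.f i ^ k), S.toA i (S.f i ^ k * c);
        0, S.toA i (S.f i ^ (k + j))] := by
  rw [(S.isGeneratorMatrix_normalCode_two hkj c).1, S.card_normalCode hkj.le, S.rowCount_two,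
    S.vecDegree_f_pow_left (by omega), S.vecDegree_zero_f_pow hkj.le]

theorem card_span_swap_two {i : S.Index} {k j : ℕ} (hkj : k + j < 2 ^ S.lam)
    (c : (ZMod 2)[X]) :
    Nat.card (Submodule.span (S.A i) (Set.range
      (!![S.toA i (S.f i ^ k * c), S.toA i (S.f i ^ k); S.toA i (S.f i ^ (k + j)), 0] :
        Matrix (Fin 2) _ _).row)) =
      S.rowCount !![S.toA i (S.f i ^ k * c), S.toA i (S.f i ^ k);
        S.toA i (S.f i ^ (k + j)), 0] := by
  rw [(S.isGeneratorMatrix_swapCode_two hkj c).1, card_swapCode, S.card_normalCode hkj.le,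
    S.rowCount_two, S.vecDegree_f_pow_right (by omega), S.vecDegree_f_pow_zero hkj.le]

theorem IsStandard.card_span_eq_rowCount {S : DihedralSetup m} {i : S.Index} {n : ℕ}
    {G : Matrix (Fin n) (Fin 2) (S.A i)} (hG : S.IsStandard i G) :
    Nat.card (Submodule.span (S.A i) (Set.range G.row)) = S.rowCount G := by
  have hN : 0 < 2 ^ S.lam := by positivity
  cases hG with
  | case1 a ha =>
    have h := S.card_span_normal_one (i := i) hN a
    rwa [pow_zero, one_mul, map_one] at h
  | case2 k hk hk' a ha => exact S.card_span_normal_one (by omega) a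
  | case3 b hb =>
    have h := S.card_span_swap_one (i := i) hN (S.f i * b)
    rwa [pow_zero, one_mul, map_one] at h
  | case4 k hk hk' b hb =>
    have h := S.card_span_swap_one (i := i) (k := k) (by omega) (S.f i * b)
    rwa [← mul_assoc, ← pow_succ] at h
  | case5 k hk =>
    rw [(S.isGeneratorMatrix_normalCode_scalar hk).1, S.card_normalCode hk, S.rowCount_two,
      S.vecDegree_f_pow_zero hk, S.vecDegree_zero_f_pow hk, add_zero]
  | case6 j hj hj' c hc =>
    have h := S.card_span_normal_two (i := i) (k := 0) (j := j) (by omega) c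
    rwa [zero_add, pow_zero, one_mul, map_one] at h
  | case7 k j hk hk' hj hj' c hc => exact S.card_span_normal_two (by omega) c
  | case8 j hj hj' c hc hfc =>
    have h := S.card_span_swap_two (i := i) (k := 0) (j := j) (by omega) c
    rwa [zero_add, pow_zero, one_mul, map_one] at h
  | case9 k j hk hk' hj hj' c hc hfc => exact S.card_span_swap_two (by omega) c

theorem IsSymmetric.isStandard {S : DihedralSetup m} {i : Fin (S.ρ + 1)} {n : ℕ}
    {G : Matrix (Fin n) (Fin 2) (S.A (Sum.inl i))} (hG : S.IsSymmetric i G) :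
    S.IsStandard (Sum.inl i) G := by
  cases hG with
  | caseI a ha => exact .case1 a ha.1
  | caseII k hk hk' a ha => exact .case2 k hk hk' a ha.1
  | caseIII k hk => exact .case5 k hk
  | caseIV j hj hj' c hc => exact .case6 j hj hj' c hc.1
  | caseV k j hk hk' hj hj' c hc => exact .case7 k j hk hk' hj hj' c hc.1

/-- The rows of each of the five kinds of generator matrices span
`f_i^k (A_i (1, c) + f_i^j A_i²)` for some `k`, `j` and some `c` with `c(x) c(x⁻¹) ≡ 1`. -/
theorem IsSymmetric.isBarStable_span {S : DihedralSetup m} {i : Fin (S.ρ + 1)} {n : ℕ}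
    {G : Matrix (Fin n) (Fin 2) (S.A (Sum.inl i))} (hG : S.IsSymmetric i G) :
    S.IsBarStable i (Submodule.span (S.A (Sum.inl i)) (Set.range G.row)) := by
  have hN : 0 < 2 ^ S.lam := by positivity
  cases hG with
  | caseI a ha =>
    have h := (S.isGeneratorMatrix_normalCode_one (i := Sum.inl i)
      (zero_add (2 ^ S.lam)) hN a).1
    rw [pow_zero, one_mul, map_one] at h
    rw [h, S.isBarStable_normalCode_iff (by omega)]
    exact ha.2
  | caseII k hk hk' a ha =>
    rw [(S.isGeneratorMatrix_normalCode_one (i := Sum.inl i)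
      (Nat.add_sub_cancel' (by omega : k ≤ 2 ^ S.lam)) (by omega) a).1,
      S.isBarStable_normalCode_iff (by omega)]
    exact ha.2
  | caseIII k hk =>
    rw [(S.isGeneratorMatrix_normalCode_scalar hk).1, S.isBarStable_normalCode_iff (by omega),
      pow_zero]
    exact one_dvd _
  | caseIV j hj hj' c hc =>
    have h := (S.isGeneratorMatrix_normalCode_two (i := Sum.inl i) (k := 0) (j := j)
      (by omega) c).1
    rw [zero_add, pow_zero, one_mul, map_one] at h
    rw [h, S.isBarStable_normalCode_iff (by omega)]
    exact hc.2
  | caseV k j hk hk' hj hj' c hc =>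
    rw [(S.isGeneratorMatrix_normalCode_two (i := Sum.inl i) (k := k) (j := j) (by omega) c).1,
      S.isBarStable_normalCode_iff (by omega)]
    exact hc.2

/-- The codes with one of the five kinds of generator matrices are exactly the stable ones. -/
theorem exists_isSymmetric_iff {i : Fin (S.ρ + 1)} (C : S.LinearCode (Sum.inl i)) :
    (∃ (n : ℕ) (G : Matrix (Fin n) (Fin 2) (S.A (Sum.inl i))),
      S.IsSymmetric i G ∧ S.IsGeneratorMatrix G C) ↔ S.IsBarStable i C := by
  constructor
  · rintro ⟨n, G, hG, hC, -⟩
    rw [← hC]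
    exact hG.isBarStable_span
  · intro hC
    obtain ⟨k, j, c, hkj, hc, rfl⟩ := hC.exists_normalForm
    exact S.exists_isSymmetric hkj hc

/-! ### The decomposition of `𝒜²` -/

/-- The polynomial whose class in `𝒜` is the idempotent `ε_i`. -/
def idemPoly (i : S.Index) : (ZMod 2)[X] :=
  Polynomial.expand (ZMod 2) (2 ^ S.lam) (S.u i * S.F i)

theorem expand_two_pow (k : ℕ) (g : (ZMod 2)[X]) :
    Polynomial.expand (ZMod 2) (2 ^ k) g = g ^ 2 ^ k := by
  induction k generalizing g with
  | zero => simp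
  | succ k ih => rw [pow_succ, Polynomial.expand_mul, ZMod.expand_card, map_pow, ih, ← pow_mul]

/-- Modulo `f_i^{2^λ}`, one has `ε_i = (1 - v_i f_i)^{2^λ} = 1 - (v_i f_i)^{2^λ} = 1`. -/
theorem toA_idemPoly_self (i : S.Index) : S.toA i (S.idemPoly i) = 1 := by
  have h : S.u i * S.F i = 1 - S.v i * S.f i := eq_sub_of_add_eq (S.bezout i)
  rw [idemPoly, expand_two_pow, h, sub_pow_char_pow, one_pow, map_sub, map_one, sub_eq_self,
    toA_eq_zero_iff, mul_pow]
  exact Dvd.intro_left _ rfl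

theorem toA_idemPoly_of_ne {i j : S.Index} (h : i ≠ j) : S.toA j (S.idemPoly i) = 0 := by
  have h1 : S.f j ∣ S.F i := by
    refine (S.f_coprime h.symm).dvd_of_dvd_mul_left ?_
    rw [f_mul_F]
    exact S.f_dvd j
  rw [idemPoly, expand_two_pow, toA_eq_zero_iff]
  exact pow_dvd_pow_of_dvd (h1.mul_left _) _

/-- The class in `𝒜` of a polynomial. -/
abbrev _root_.toCyclic (m : ℕ) : (ZMod 2)[X] →+* CyclicAlgebra m := Ideal.Quotient.mk _

/-- The reduction `𝒜 → A_i`. -/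
def proj (i : S.Index) : CyclicAlgebra m →ₗ[(ZMod 2)[X]] S.A i :=
  Submodule.factor (Ideal.span_singleton_le_span_singleton.2 (S.f_pow_dvd i))

theorem proj_toCyclic (i : S.Index) (p : (ZMod 2)[X]) : S.proj i (toCyclic m p) = S.toA i p := rfl

theorem φ_toA (i : S.Index) (p : (ZMod 2)[X]) :
    S.φ i (S.toA i p) = toCyclic m (S.idemPoly i * p) := rfl

theorem proj_φ_self (i : S.Index) (a : S.A i) : S.proj i (S.φ i a) = a := by
  obtain ⟨p, rfl⟩ := Ideal.Quotient.mk_surjective a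
  rw [φ_toA, proj_toCyclic, map_mul, toA_idemPoly_self, one_mul]

theorem proj_φ_of_ne {i j : S.Index} (h : i ≠ j) (a : S.A i) : S.proj j (S.φ i a) = 0 := by
  obtain ⟨p, rfl⟩ := Ideal.Quotient.mk_surjective a
  rw [φ_toA, proj_toCyclic, map_mul, S.toA_idemPoly_of_ne h, zero_mul]

/-- The polynomial `x^{4m} - 1` is the product of the pairwise coprime `f_i^{2^λ}`. -/
theorem eq_zero_of_proj_eq_zero {a : CyclicAlgebra m} (h : ∀ i, S.proj i a = 0) : a = 0 := by
  obtain ⟨p, rfl⟩ := Ideal.Quotient.mk_surjective a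
  rw [Ideal.Quotient.eq_zero_iff_mem, Ideal.mem_span_singleton, S.X_pow_four_mul_sub_one,
    S.f_prod, ← Finset.prod_pow]
  exact Finset.prod_dvd_of_coprime (fun i _ j _ hij => (S.f_coprime hij).pow)
    fun i _ => S.toA_eq_zero_iff.1 (h i)

theorem sum_φ_proj (a : CyclicAlgebra m) : ∑ i, S.φ i (S.proj i a) = a := by
  rw [← sub_eq_zero]
  refine S.eq_zero_of_proj_eq_zero fun j => ?_
  rw [map_sub, map_sum, Finset.sum_eq_single j, proj_φ_self, sub_self]
  · intro i _ hij
    exact S.proj_φ_of_ne hij _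
  · intro h
    exact absurd (Finset.mem_univ j) h

/-- The reduction `𝒜² → A_i²`. -/
def projVec (i : S.Index) : (Fin 2 → CyclicAlgebra m) →ₗ[(ZMod 2)[X]] (Fin 2 → S.A i) :=
  (S.proj i).compLeft (Fin 2)

/-- The embedding `A_i² → 𝒜²`, `(ξ₀, ξ₁) ↦ (φ_i(ξ₀), φ_i(ξ₁))`. -/
def φVec (i : S.Index) : (Fin 2 → S.A i) →ₗ[(ZMod 2)[X]] (Fin 2 → CyclicAlgebra m) :=
  (S.φ i).compLeft (Fin 2)

theorem projVec_φVec_self (i : S.Index) (w : Fin 2 → S.A i) : S.projVec i (S.φVec i w) = w :=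
  funext fun t => S.proj_φ_self i (w t)

theorem projVec_φVec_of_ne {i j : S.Index} (h : i ≠ j) (w : Fin 2 → S.A i) :
    S.projVec j (S.φVec i w) = 0 :=
  funext fun t => S.proj_φ_of_ne h (w t)

theorem sum_φVec_projVec (w : Fin 2 → CyclicAlgebra m) : ∑ i, S.φVec i (S.projVec i w) = w := by
  ext t
  rw [Finset.sum_apply]
  exact S.sum_φ_proj (w t)

theorem exists_eq_toCyclic (w : Fin 2 → CyclicAlgebra m) :
    ∃ a b, w = ![toCyclic m a, toCyclic m b] := by
  obtain ⟨a, ha⟩ := Ideal.Quotient.mk_surjective (w 0)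
  obtain ⟨b, hb⟩ := Ideal.Quotient.mk_surjective (w 1)
  refine ⟨a, b, ?_⟩
  ext t
  fin_cases t
  · exact ha.symm
  · exact hb.symm

theorem projVec_toCyclic (i : S.Index) (a b : (ZMod 2)[X]) :
    S.projVec i ![toCyclic m a, toCyclic m b] = ![S.toA i a, S.toA i b] := by
  ext t
  fin_cases t <;> rfl

theorem φVec_toA (i : S.Index) (a b : (ZMod 2)[X]) :
    S.φVec i ![S.toA i a, S.toA i b] =
      ![toCyclic m (S.idemPoly i * a), toCyclic m (S.idemPoly i * b)] := by
  ext t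
  fin_cases t <;> rfl

theorem φVec_projVec (i : S.Index) (w : Fin 2 → CyclicAlgebra m) :
    S.φVec i (S.projVec i w) = S.idemPoly i • w := by
  obtain ⟨a, b, rfl⟩ := exists_eq_toCyclic w
  rw [projVec_toCyclic, φVec_toA]
  ext t
  fin_cases t <;> rfl

theorem mem_concat {i : S.Index} {C : S.LinearCode i} {w : Fin 2 → CyclicAlgebra m} :
    w ∈ S.concat i C ↔ ∃ v ∈ C, S.φVec i v = w := Iff.rfl

theorem mem_iSup_concat_iff (C : (i : S.Index) → S.LinearCode i) (w : Fin 2 → CyclicAlgebra m) :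
    w ∈ (⨆ i, S.concat i (C i) : Submodule (ZMod 2)[X] (Fin 2 → CyclicAlgebra m)) ↔
      ∀ i, S.projVec i w ∈ C i := by
  constructor
  · intro hw i
    have hle : (⨆ j, S.concat j (C j)) ≤
        ((C i).restrictScalars (ZMod 2)[X]).comap (S.projVec i) := by
      refine iSup_le fun j w hw => ?_
      obtain ⟨v, hv, rfl⟩ := S.mem_concat.1 hw
      rw [Submodule.mem_comap, Submodule.restrictScalars_mem]
      by_cases hij : j = i
      · subst hij
        rw [projVec_φVec_self]
        exact hv
      · rw [S.projVec_φVec_of_ne hij]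
        exact Submodule.zero_mem _
    exact Submodule.mem_comap.1 (hle hw)
  · intro h
    rw [← S.sum_φVec_projVec w]
    exact Submodule.sum_mem _ fun i _ =>
      Submodule.mem_iSup_of_mem i (S.mem_concat.2 ⟨S.projVec i w, h i, rfl⟩)

theorem iSupIndep_concat (C : (i : S.Index) → S.LinearCode i) :
    iSupIndep fun i => S.concat i (C i) := by
  intro i
  rw [Submodule.disjoint_def]
  intro w hw h
  obtain ⟨v, hv, rfl⟩ := S.mem_concat.1 hw
  have hle : (⨆ j, ⨆ (_ : j ≠ i), S.concat j (C j)) ≤ LinearMap.ker (S.projVec i) := by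
    refine iSup₂_le fun j hj w hw => ?_
    obtain ⟨v, hv, rfl⟩ := S.mem_concat.1 hw
    exact S.projVec_φVec_of_ne hj v
  have h1 : S.projVec i (S.φVec i v) = 0 := hle h
  rw [projVec_φVec_self] at h1
  rw [h1, map_zero]

theorem φVec_mem_iSup_concat {C : (i : S.Index) → S.LinearCode i} {i : S.Index}
    {v : Fin 2 → S.A i} (hv : v ∈ C i) :
    S.φVec i v ∈ (⨆ i, S.concat i (C i) : Submodule (ZMod 2)[X] (Fin 2 → CyclicAlgebra m)) :=
  Submodule.mem_iSup_of_mem i (S.mem_concat.2 ⟨v, hv, rfl⟩)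

theorem iSup_concat_injective {C D : (i : S.Index) → S.LinearCode i}
    (h : (⨆ i, S.concat i (C i)) = ⨆ i, S.concat i (D i)) : C = D := by
  have key : ∀ {C D : (i : S.Index) → S.LinearCode i},
      (⨆ i, S.concat i (C i)) = (⨆ i, S.concat i (D i)) → ∀ i, C i ≤ D i := by
    intro C D h i v hv
    have h1 := S.φVec_mem_iSup_concat hv
    rw [h, mem_iSup_concat_iff] at h1
    have h2 := h1 i
    rwa [projVec_φVec_self] at h2
  exact funext fun i => le_antisymm (key h i) (key h.symm i)

/-- `ε_i` acts on `𝒜²` as the projection to the summand of index `i`, so every submodule is the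
sum of its projections. -/
theorem exists_eq_iSup_concat (P : Submodule (ZMod 2)[X] (Fin 2 → CyclicAlgebra m)) :
    ∃ C : (i : S.Index) → S.LinearCode i, P = ⨆ i, S.concat i (C i) := by
  let C : (i : S.Index) → S.LinearCode i := fun i =>
    { (P.map (S.projVec i)).toAddSubmonoid with
      smul_mem' := by
        intro x v hv
        obtain ⟨x, rfl⟩ := Ideal.Quotient.mk_surjective x
        exact (P.map (S.projVec i)).smul_mem x hv }
  refine ⟨C, le_antisymm (fun w hw => ?_) (fun w hw => ?_)⟩
  · exact (S.mem_iSup_concat_iff C w).2 fun i => ⟨w, hw, rfl⟩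
  · have h := (S.mem_iSup_concat_iff C w).1 hw
    rw [← S.sum_φVec_projVec w]
    refine Submodule.sum_mem _ fun i _ => ?_
    obtain ⟨v, hv, hvw⟩ := h i
    rw [← hvw]
    rw [φVec_projVec]
    exact P.smul_mem _ hv

theorem card_iSup_concat (C : (i : S.Index) → S.LinearCode i) :
    Nat.card (⨆ i, S.concat i (C i) : Submodule (ZMod 2)[X] (Fin 2 → CyclicAlgebra m)) =
      ∏ i, Nat.card (C i) := by
  rw [← Nat.card_pi]
  refine Nat.card_congr (Equiv.ofBijective
    (fun w i => ⟨S.projVec i w.1, (S.mem_iSup_concat_iff C w.1).1 w.2 i⟩) ⟨?_, ?_⟩)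
  · intro w w' h
    refine Subtype.ext ?_
    rw [← S.sum_φVec_projVec w.1, ← S.sum_φVec_projVec w'.1]
    exact Finset.sum_congr rfl fun i _ => congrArg _ (congrArg Subtype.val (congrFun h i))
  · intro v
    refine ⟨⟨∑ i, S.φVec i (v i).1, Submodule.sum_mem _ fun i _ =>
      S.φVec_mem_iSup_concat (v i).2⟩, ?_⟩
    funext j
    refine Subtype.ext ?_
    change S.projVec j (∑ i, S.φVec i (v i).1) = (v j).1
    rw [map_sum, Finset.sum_eq_single j, projVec_φVec_self]
    · intro i _ hij
      exact S.projVec_φVec_of_ne hij _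
    · intro h
      exact absurd (Finset.mem_univ j) h

/-! ### Admissible families -/

theorem toA_polyBar_congr {i i' : S.Index} (hi : S.star i = i') {a b : (ZMod 2)[X]}
    (h : S.toA i a = S.toA i b) : S.toA i' (polyBar m a) = S.toA i' (polyBar m b) := by
  subst hi
  rw [toA_eq_toA_iff] at h ⊢
  rw [← map_sub]
  exact S.f_star_pow_dvd_polyBar h

theorem toA_polyBar_polyBar (i : S.Index) (a : (ZMod 2)[X]) :
    S.toA i (polyBar m (polyBar m a)) = S.toA i a := by
  rw [toA_eq_toA_iff]
  exact (S.f_pow_dvd i).trans (X_pow_sub_one_dvd_polyBar_polyBar_sub S.m_pos a)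

theorem toA_eq_toA_polyBar {i i' : S.Index} (hi : S.star i = i') {a b : (ZMod 2)[X]}
    (h : S.toA i a = S.toA i (polyBar m b)) : S.toA i' (polyBar m a) = S.toA i' b := by
  rw [S.toA_polyBar_congr hi h, toA_polyBar_polyBar]

/-- The code `{(b(x⁻¹), a(x⁻¹)) | (a, b) ∈ C}` over `A_{i'}`, for `f_{i'} = f_i^*`. -/
def barImage {i : S.Index} (i' : S.Index) (C : S.LinearCode i) : S.LinearCode i' where
  carrier := {w | ∃ a b, ![S.toA i a, S.toA i b] ∈ C ∧
    w = ![S.toA i' (polyBar m b), S.toA i' (polyBar m a)]}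
  add_mem' := by
    rintro _ _ ⟨a, b, hab, rfl⟩ ⟨a', b', hab', rfl⟩
    refine ⟨a + a', b + b', ?_, ?_⟩
    · rw [← toA_vec_add]
      exact C.add_mem hab hab'
    · rw [toA_vec_add, map_add (polyBar m), map_add (polyBar m)]
  zero_mem' := by
    refine ⟨0, 0, ?_, ?_⟩
    · convert C.zero_mem using 1
      ext t
      fin_cases t <;> simp
    · ext t
      fin_cases t <;> simp
  smul_mem' := by
    rintro x _ ⟨a, b, hab, rfl⟩
    obtain ⟨x, rfl⟩ := Ideal.Quotient.mk_surjective x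
    refine ⟨polyBar m x * a, polyBar m x * b, ?_, ?_⟩
    · rw [← smul_toA_vec]
      exact C.smul_mem _ hab
    · rw [smul_toA_vec]
      simp only [map_mul (polyBar m), map_mul (S.toA _), toA_polyBar_polyBar]

theorem coe_barImage {i : S.Index} (i' : S.Index) (C : S.LinearCode i) :
    (S.barImage i' C : Set (Fin 2 → S.A i')) =
      {w | ∃ a b : (ZMod 2)[X], ![S.toA i a, S.toA i b] ∈ C ∧
        w = ![S.toA i' (b.comp (Polynomial.X ^ (4 * m - 1))),
          S.toA i' (a.comp (Polynomial.X ^ (4 * m - 1)))]} := by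
  simp only [← polyBar_apply]
  rfl

theorem mem_barImage {i i' : S.Index} (hi : S.star i' = i) {C : S.LinearCode i}
    {a b : (ZMod 2)[X]} :
    ![S.toA i' a, S.toA i' b] ∈ S.barImage i' C ↔
      ![S.toA i (polyBar m b), S.toA i (polyBar m a)] ∈ C := by
  constructor
  · rintro ⟨a', b', hab, hw⟩
    rwa [S.toA_eq_toA_polyBar hi (congrFun hw 0), S.toA_eq_toA_polyBar hi (congrFun hw 1)]
  · intro h
    exact ⟨_, _, h, by rw [toA_polyBar_polyBar, toA_polyBar_polyBar]⟩

theorem card_barImage {i i' : S.Index} (hi : S.star i' = i) (C : S.LinearCode i) :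
    Nat.card (S.barImage i' C) = Nat.card C := by
  have hi' : S.star i = i' := by rw [← hi, star_star]
  symm
  choose p q hpq using fun v : Fin 2 → S.A i => S.exists_eq_toA v
  refine Nat.card_congr (Equiv.ofBijective
    (fun v : C => (⟨![S.toA i' (polyBar m (q v.1)), S.toA i' (polyBar m (p v.1))],
      p v.1, q v.1, (hpq v.1) ▸ v.2, rfl⟩ : S.barImage i' C)) ⟨?_, ?_⟩)
  · intro v v' h
    have h0 := congrArg Subtype.val h
    have h1 := S.toA_eq_toA_polyBar hi (congrFun h0 0)
    have h2 := S.toA_eq_toA_polyBar hi (congrFun h0 1)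
    rw [toA_polyBar_polyBar] at h1 h2
    refine Subtype.ext ?_
    rw [hpq v.1, hpq v'.1, h1, h2]
  · rintro ⟨_, a, b, hab, rfl⟩
    refine ⟨⟨_, hab⟩, Subtype.ext ?_⟩
    have h := hpq ![S.toA i a, S.toA i b]
    have h0 : S.toA i a = _ := congrFun h 0
    have h1 : S.toA i b = _ := congrFun h 1
    dsimp only
    rw [S.toA_polyBar_congr hi' h0, S.toA_polyBar_congr hi' h1]

/-- The family `(C_i)` is stable under the maps `A_i² → A_{i'}²`, `f_{i'} = f_i^*`,
`(a, b) ↦ (b(x⁻¹), a(x⁻¹))`, which the left multiplication by `y` induces. -/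
def IsBarStableFamily (C : (i : S.Index) → S.LinearCode i) : Prop :=
  ∀ i i', S.star i = i' → ∀ a b, ![S.toA i a, S.toA i b] ∈ C i →
    ![S.toA i' (polyBar m b), S.toA i' (polyBar m a)] ∈ C i'

theorem isAdmissible_iff (C : (i : S.Index) → S.LinearCode i) :
    S.IsAdmissible C ↔ (∀ i, S.IsBarStable i (C (Sum.inl i))) ∧
      ∀ j, C (Sum.inr (Sum.inr j)) =
        S.barImage (Sum.inr (Sum.inr j)) (C (Sum.inr (Sum.inl j))) := by
  constructor
  · rintro ⟨h1, -, h3⟩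
    exact ⟨fun i => (S.exists_isSymmetric_iff _).1 (h1 i),
      fun j => SetLike.coe_injective ((h3 j).trans (S.coe_barImage _ _).symm)⟩
  · rintro ⟨h1, h3⟩
    exact ⟨fun i => (S.exists_isSymmetric_iff _).2 (h1 i), fun j => S.exists_isStandard _,
      fun j => (congrArg SetLike.coe (h3 j)).trans (S.coe_barImage _ _)⟩

/-- For a reciprocal pair, stability in both directions says that one code is the image of the
other, since `x ↦ x⁻¹` is an involution. -/
theorem isBarStableFamily_iff_isAdmissible (C : (i : S.Index) → S.LinearCode i) :
    S.IsBarStableFamily C ↔ S.IsAdmissible C := by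
  rw [isAdmissible_iff]
  constructor
  · refine fun h => ⟨fun i => h _ _ rfl, fun j => linearCode_ext fun a b => ?_⟩
    rw [S.mem_barImage (S.star_inr_inr j)]
    refine ⟨h _ _ (S.star_inr_inr j) a b, fun hab => ?_⟩
    have h1 := h _ _ (S.star_inr_inl j) _ _ hab
    rwa [toA_polyBar_polyBar, toA_polyBar_polyBar] at h1
  · rintro ⟨h1, h3⟩ (i | j | j) _ rfl a b hab
    · exact h1 i a b hab
    · change _ ∈ C (Sum.inr (Sum.inr j))
      rw [h3 j]
      exact ⟨a, b, hab, rfl⟩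
    · rw [h3 j] at hab
      exact (S.mem_barImage (S.star_inr_inr j)).1 hab

/-- An admissible family amounts to stable codes `C_i` for `i ≤ ρ` and arbitrary codes `C_i` for
`ρ < i ≤ ρ + ε`. -/
theorem card_isAdmissible :
    Nat.card {C : (i : S.Index) → S.LinearCode i // S.IsAdmissible C} =
      (∏ i : Fin (S.ρ + 1), S.numSymmetric i) *
        ∏ j : Fin S.ε, S.numLinear (Sum.inr (Sum.inl j)) := by
  simp only [← card_isBarStable, ← card_linearCode]
  rw [← Nat.card_pi, ← Nat.card_pi, ← Nat.card_prod]
  refine Nat.card_congr (Equiv.ofBijective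
    (fun C => (fun i => ⟨C.1 (Sum.inl i), ((S.isAdmissible_iff C.1).1 C.2).1 i⟩,
      fun j => C.1 (Sum.inr (Sum.inl j)))) ⟨?_, ?_⟩)
  · rintro ⟨C, hC⟩ ⟨D, hD⟩ h
    obtain ⟨h1, h2⟩ := Prod.ext_iff.1 h
    refine Subtype.ext (funext ?_)
    rintro (i | j | j)
    · exact congrArg Subtype.val (congrFun h1 i)
    · exact congrFun h2 j
    · have h3 : C (Sum.inr (Sum.inl j)) = D (Sum.inr (Sum.inl j)) := congrFun h2 j
      change C (Sum.inr (Sum.inr j)) = D (Sum.inr (Sum.inr j))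
      rw [((S.isAdmissible_iff C).1 hC).2 j, ((S.isAdmissible_iff D).1 hD).2 j, h3]
  · rintro ⟨D, E⟩
    let C : (i : S.Index) → S.LinearCode i
      | Sum.inl i => (D i).1
      | Sum.inr (Sum.inl j) => E j
      | Sum.inr (Sum.inr j) => S.barImage (Sum.inr (Sum.inr j)) (E j)
    exact ⟨⟨C, (S.isAdmissible_iff C).2 ⟨fun i => (D i).2, fun j => rfl⟩⟩, rfl⟩

end DihedralSetup

/-! ### Left ideals of `𝔽₂[D_{8m}]` -/

theorem cyclicIncl_toCyclic (m : ℕ) (p : (ZMod 2)[X]) :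
    cyclicIncl m (toCyclic m p) = Polynomial.aeval
      (MonoidAlgebra.of (ZMod 2) (DihedralGroup (4 * m)) (DihedralGroup.r 1)) p := rfl

theorem cyclicIncl_mul_dihedralTheta (m : ℕ) (p : (ZMod 2)[X]) (w : Fin 2 → CyclicAlgebra m) :
    cyclicIncl m (toCyclic m p) * dihedralTheta m w = dihedralTheta m (p • w) := by
  have h : ∀ t, (p • w) t = toCyclic m p * w t := fun t => Algebra.smul_def p (w t)
  rw [dihedralTheta, dihedralTheta, h, h, map_mul, map_mul, mul_add, mul_assoc]

theorem dihedralTheta_add (m : ℕ) (v w : Fin 2 → CyclicAlgebra m) :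
    dihedralTheta m (v + w) = dihedralTheta m v + dihedralTheta m w := by
  simp only [dihedralTheta, Pi.add_apply, map_add, add_mul]
  abel

theorem dihedralTheta_zero (m : ℕ) : dihedralTheta m 0 = 0 := by
  simp only [dihedralTheta, Pi.zero_apply, map_zero, zero_mul, add_zero]

/-- The relation `y p(x) = p(x⁻¹) y`. -/
theorem of_sr_zero_mul_cyclicIncl {m : ℕ} (hm : 0 < m) (p : (ZMod 2)[X]) :
    MonoidAlgebra.of (ZMod 2) (DihedralGroup (4 * m)) (DihedralGroup.sr 0) *
        cyclicIncl m (toCyclic m p) =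
      cyclicIncl m (toCyclic m (polyBar m p)) *
        MonoidAlgebra.of (ZMod 2) (DihedralGroup (4 * m)) (DihedralGroup.sr 0) := by
  rw [cyclicIncl_toCyclic, cyclicIncl_toCyclic, polyBar_apply, Polynomial.aeval_comp, map_pow,
    Polynomial.aeval_X]
  set x := MonoidAlgebra.of (ZMod 2) (DihedralGroup (4 * m)) (DihedralGroup.r 1)
  set y := MonoidAlgebra.of (ZMod 2) (DihedralGroup (4 * m)) (DihedralGroup.sr 0)
  have hyx : SemiconjBy y x (x ^ (4 * m - 1)) := by
    rw [SemiconjBy, ← map_pow, ← map_mul, ← map_mul, DihedralGroup.r_one_pow,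
      DihedralGroup.r_mul_sr, DihedralGroup.sr_mul_r, Nat.cast_sub (by omega),
      ZMod.natCast_self, Nat.cast_one]
    congr 2
    abel
  induction p using Polynomial.induction_on' with
  | add p q hp hq => rw [map_add, map_add, mul_add, add_mul, hp, hq]
  | monomial n a =>
    rw [Polynomial.aeval_monomial, Polynomial.aeval_monomial, ← mul_assoc,
      ← Algebra.commutes a y, mul_assoc, mul_assoc, (hyx.pow_right n).eq]

theorem of_sr_zero_mul_dihedralTheta {m : ℕ} (hm : 0 < m) (a b : (ZMod 2)[X]) :
    MonoidAlgebra.of (ZMod 2) (DihedralGroup (4 * m)) (DihedralGroup.sr 0) *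
        dihedralTheta m ![toCyclic m a, toCyclic m b] =
      dihedralTheta m ![toCyclic m (polyBar m b), toCyclic m (polyBar m a)] := by
  have hy : MonoidAlgebra.of (ZMod 2) (DihedralGroup (4 * m)) (DihedralGroup.sr 0) *
      MonoidAlgebra.of (ZMod 2) (DihedralGroup (4 * m)) (DihedralGroup.sr 0) = 1 := by
    rw [← map_mul, DihedralGroup.sr_mul_self, map_one]
  simp only [dihedralTheta, Matrix.cons_val_zero, Matrix.cons_val_one]
  rw [mul_add, ← mul_assoc, of_sr_zero_mul_cyclicIncl hm, of_sr_zero_mul_cyclicIncl hm,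
    mul_assoc _ _ (MonoidAlgebra.of _ _ _), hy, mul_one, add_comm]

theorem dihedralTheta_surjective {m : ℕ} (hm : 0 < m) :
    Function.Surjective (dihedralTheta m) := by
  have : NeZero (4 * m) := ⟨by omega⟩
  have hr : ∀ i : ZMod (4 * m), cyclicIncl m (toCyclic m (Polynomial.X ^ i.val)) =
      MonoidAlgebra.of (ZMod 2) (DihedralGroup (4 * m)) (DihedralGroup.r i) := by
    intro i
    rw [cyclicIncl_toCyclic, map_pow, Polynomial.aeval_X, ← map_pow, DihedralGroup.r_one_pow,
      ZMod.natCast_zmod_val]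
  intro z
  induction z using MonoidAlgebra.induction_on with
  | of g =>
    rcases g with i | i
    · refine ⟨![toCyclic m (Polynomial.X ^ i.val), 0], ?_⟩
      simp only [dihedralTheta, Matrix.cons_val_zero, Matrix.cons_val_one, map_zero, zero_mul,
        add_zero]
      exact hr i
    · refine ⟨![0, toCyclic m (Polynomial.X ^ (-i).val)], ?_⟩
      simp only [dihedralTheta, Matrix.cons_val_zero, Matrix.cons_val_one, map_zero, zero_add]
      rw [hr, ← map_mul, DihedralGroup.r_mul_sr, zero_sub, neg_neg]
  | add v w hv hw =>
    obtain ⟨v, rfl⟩ := hv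
    obtain ⟨w, rfl⟩ := hw
    exact ⟨v + w, dihedralTheta_add m v w⟩
  | smul c v hv =>
    obtain ⟨v, rfl⟩ := hv
    refine ⟨(Polynomial.C c : (ZMod 2)[X]) • v, ?_⟩
    rw [← cyclicIncl_mul_dihedralTheta, cyclicIncl_toCyclic, Polynomial.aeval_C,
      Algebra.smul_def]

theorem card_cyclicAlgebra {m : ℕ} (hm : 0 < m) :
    Finite (CyclicAlgebra m) ∧ Nat.card (CyclicAlgebra m) = 2 ^ (4 * m) := by
  have hmonic : (Polynomial.X ^ (4 * m) - 1 : (ZMod 2)[X]).Monic :=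
    Polynomial.monic_X_pow_sub_C 1 (by omega)
  have hfin : Module.Finite (ZMod 2) (CyclicAlgebra m) := hmonic.finite_quotient
  have hrank : Module.finrank (ZMod 2) (CyclicAlgebra m) = 4 * m :=
    (finrank_quotient_span_eq_natDegree).trans (Polynomial.natDegree_X_pow_sub_C)
  refine ⟨Module.finite_of_finite (ZMod 2), ?_⟩
  rw [Module.natCard_eq_pow_finrank (K := ZMod 2), hrank, Nat.card_zmod]

/-- `Θ` is surjective and both sides have `2^{8m}` elements. -/
theorem dihedralTheta_injective {m : ℕ} (hm : 0 < m) :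
    Function.Injective (dihedralTheta m) := by
  have : NeZero (4 * m) := ⟨by omega⟩
  have hfin := (card_cyclicAlgebra hm).1
  have hcard : Nat.card (DihedralAlgebra m) = 2 ^ (8 * m) := by
    rw [Nat.card_congr (MonoidAlgebra.coeffEquiv.trans Finsupp.equivFunOnFinite), Nat.card_fun,
      DihedralGroup.nat_card, Nat.card_zmod]
    congr 1
    omega
  have hcard' : Nat.card (Fin 2 → CyclicAlgebra m) = 2 ^ (8 * m) := by
    rw [Nat.card_fun, (card_cyclicAlgebra hm).2, Nat.card_fin, ← pow_mul]
    congr 1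
    omega
  have hfin' : Finite (DihedralAlgebra m) := Nat.finite_of_card_ne_zero (by rw [hcard]; positivity)
  exact ((Nat.bijective_iff_surjective_and_card _).2
    ⟨dihedralTheta_surjective hm, hcard'.trans hcard.symm⟩).1

/-- A submodule of `𝒜²` is stable under `(a, b) ↦ (b(x⁻¹), a(x⁻¹))`, that is, its image in
`𝔽₂[D_{8m}]` is stable under left multiplication by `y`. -/
def IsBarStableSubmodule {m : ℕ} (P : Submodule (ZMod 2)[X] (Fin 2 → CyclicAlgebra m)) : Prop :=
  ∀ a b, ![toCyclic m a, toCyclic m b] ∈ P →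
    ![toCyclic m (polyBar m b), toCyclic m (polyBar m a)] ∈ P

theorem exists_isBarStableSubmodule {m : ℕ} (hm : 0 < m) (I : Ideal (DihedralAlgebra m)) :
    ∃ P : Submodule (ZMod 2)[X] (Fin 2 → CyclicAlgebra m), IsBarStableSubmodule P ∧
      (I : Set (DihedralAlgebra m)) = dihedralTheta m '' P := by
  let P : Submodule (ZMod 2)[X] (Fin 2 → CyclicAlgebra m) :=
    { carrier := dihedralTheta m ⁻¹' I
      add_mem' := by
        intro v w hv hw
        rw [Set.mem_preimage, dihedralTheta_add]
        exact I.add_mem hv hw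
      zero_mem' := by
        rw [Set.mem_preimage, dihedralTheta_zero]
        exact I.zero_mem
      smul_mem' := by
        intro p w hw
        rw [Set.mem_preimage, ← cyclicIncl_mul_dihedralTheta]
        exact I.mul_mem_left _ hw }
  refine ⟨P, fun a b hab => ?_, ?_⟩
  · change dihedralTheta m _ ∈ I
    rw [← of_sr_zero_mul_dihedralTheta hm]
    exact I.mul_mem_left _ hab
  · exact (Set.image_preimage_eq _ (dihedralTheta_surjective hm)).symm

theorem IsBarStableSubmodule.exists_ideal {m : ℕ} (hm : 0 < m)
    {P : Submodule (ZMod 2)[X] (Fin 2 → CyclicAlgebra m)} (hP : IsBarStableSubmodule P) :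
    ∃ I : Ideal (DihedralAlgebra m), (I : Set (DihedralAlgebra m)) = dihedralTheta m '' P := by
  let I : Ideal (DihedralAlgebra m) :=
    { carrier := dihedralTheta m '' P
      add_mem' := by
        rintro _ _ ⟨v, hv, rfl⟩ ⟨w, hw, rfl⟩
        exact ⟨v + w, P.add_mem hv hw, dihedralTheta_add m v w⟩
      zero_mem' := ⟨0, P.zero_mem, dihedralTheta_zero m⟩
      smul_mem' := by
        rintro z _ ⟨w, hw, rfl⟩
        -- write `z = p(x) + q(x) y` and let `y` act first
        obtain ⟨u, rfl⟩ := dihedralTheta_surjective hm z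
        obtain ⟨p, q, rfl⟩ := DihedralSetup.exists_eq_toCyclic u
        obtain ⟨a, b, rfl⟩ := DihedralSetup.exists_eq_toCyclic w
        refine ⟨p • ![toCyclic m a, toCyclic m b] +
          q • ![toCyclic m (polyBar m b), toCyclic m (polyBar m a)],
          P.add_mem (P.smul_mem p hw) (P.smul_mem q (hP a b hw)), ?_⟩
        rw [dihedralTheta_add, ← cyclicIncl_mul_dihedralTheta, ← cyclicIncl_mul_dihedralTheta,
          ← of_sr_zero_mul_dihedralTheta hm, ← mul_assoc, ← add_mul]
        rfl }
  exact ⟨I, rfl⟩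

namespace DihedralSetup

variable {m : ℕ} (S : DihedralSetup m)

theorem isBarStableSubmodule_iSup_concat_iff (C : (i : S.Index) → S.LinearCode i) :
    IsBarStableSubmodule (⨆ i, S.concat i (C i)) ↔ S.IsBarStableFamily C := by
  constructor
  · rintro h i _ rfl a b hab
    have h1 := S.φVec_mem_iSup_concat hab
    rw [φVec_toA] at h1
    have h2 := (S.mem_iSup_concat_iff C _).1 (h _ _ h1) (S.star i)
    have he : ∀ p, S.toA i (S.idemPoly i * p) = S.toA i p := by
      intro p
      rw [map_mul, toA_idemPoly_self, one_mul]
    rwa [projVec_toCyclic, S.toA_polyBar_congr rfl (he a), S.toA_polyBar_congr rfl (he b)] at h2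
  · intro h a b hab
    rw [mem_iSup_concat_iff] at hab ⊢
    intro i
    rw [projVec_toCyclic]
    refine h (S.star i) i (S.star_star i) a b ?_
    rw [← projVec_toCyclic]
    exact hab _

theorem exists_ideal_eq_assemble_iff (C : (i : S.Index) → S.LinearCode i) :
    (∃ I : Ideal (DihedralAlgebra m), (I : Set (DihedralAlgebra m)) = S.assemble C) ↔
      S.IsAdmissible C := by
  rw [← isBarStableFamily_iff_isAdmissible, ← isBarStableSubmodule_iSup_concat_iff]
  constructor
  · rintro ⟨I, hI⟩
    obtain ⟨P, hP, hIP⟩ := exists_isBarStableSubmodule S.m_pos I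
    have h := (dihedralTheta_injective S.m_pos).image_injective (hIP.symm.trans hI)
    rwa [← SetLike.coe_injective h]
  · exact fun h => h.exists_ideal S.m_pos

theorem assemble_injective : Function.Injective S.assemble := fun _ _ h =>
  S.iSup_concat_injective
    (SetLike.coe_injective ((dihedralTheta_injective S.m_pos).image_injective h))

theorem existsUnique_eq_assemble (I : Ideal (DihedralAlgebra m)) :
    ∃! C : (i : S.Index) → S.LinearCode i,
      S.IsAdmissible C ∧ (I : Set (DihedralAlgebra m)) = S.assemble C := by
  obtain ⟨P, -, hIP⟩ := exists_isBarStableSubmodule S.m_pos I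
  obtain ⟨C, rfl⟩ := S.exists_eq_iSup_concat P
  refine ⟨C, ⟨(S.exists_ideal_eq_assemble_iff C).1 ⟨I, hIP⟩, hIP⟩, ?_⟩
  rintro D ⟨-, hD⟩
  exact S.assemble_injective (hD.symm.trans hIP)

theorem card_assemble (C : (i : S.Index) → S.LinearCode i) :
    Nat.card (S.assemble C) = ∏ i, Nat.card (C i) := by
  rw [← card_iSup_concat]
  exact Nat.card_image_of_injective (dihedralTheta_injective S.m_pos) _

theorem card_ideal : Nat.card (Ideal (DihedralAlgebra m)) =
    (∏ i : Fin (S.ρ + 1), S.numSymmetric i) *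
      ∏ j : Fin S.ε, S.numLinear (Sum.inr (Sum.inl j)) := by
  rw [← card_isAdmissible]
  choose I hI using fun C : {C // S.IsAdmissible C} =>
    (S.exists_ideal_eq_assemble_iff C.1).2 C.2
  symm
  refine Nat.card_congr (Equiv.ofBijective I ⟨fun C D h => ?_, fun J => ?_⟩)
  · exact Subtype.ext (S.assemble_injective ((hI C).symm.trans ((congrArg _ h).trans (hI D))))
  · obtain ⟨C, ⟨hC, hJ⟩, -⟩ := S.existsUnique_eq_assemble J
    exact ⟨⟨C, hC⟩, SetLike.coe_injective ((hI ⟨C, hC⟩).trans hJ.symm)⟩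

end DihedralSetup

end

theorem mainTheorem7 (m : ℕ) (S : DihedralSetup m) :
    (∀ 𝒞 : Ideal (DihedralAlgebra m), ∃! C : (i : S.Index) → S.LinearCode i,
      S.IsAdmissible C ∧ (𝒞 : Set (DihedralAlgebra m)) = S.assemble C) ∧
    (∀ C : (i : S.Index) → S.LinearCode i, S.IsAdmissible C →
      (∃ 𝒞 : Ideal (DihedralAlgebra m), (𝒞 : Set (DihedralAlgebra m)) = S.assemble C) ∧
      iSupIndep (fun i => S.concat i (C i)) ∧
      Nat.card (S.assemble C) = ∏ i, Nat.card (C i) ∧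
      (∀ (i : Fin (S.ρ + 1)) (n : ℕ) (G : Matrix (Fin n) (Fin 2) (S.A (Sum.inl i))),
        S.IsSymmetric i G → S.IsGeneratorMatrix G (C (Sum.inl i)) →
          Nat.card (C (Sum.inl i)) = S.rowCount G) ∧
      (∀ (i : S.Index) (n : ℕ) (G : Matrix (Fin n) (Fin 2) (S.A i)),
        S.IsStandard i G → S.IsGeneratorMatrix G (C i) → Nat.card (C i) = S.rowCount G) ∧
      (∀ j : Fin S.ε, Nat.card (C (Sum.inr (Sum.inr j))) = Nat.card (C (Sum.inr (Sum.inl j))))) ∧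
    Nat.card (Ideal (DihedralAlgebra m)) =
      (∏ i : Fin (S.ρ + 1), S.numSymmetric i) *
        ∏ j : Fin S.ε, S.numLinear (Sum.inr (Sum.inl j)) := by
  have hcard : ∀ (i : S.Index) (C : S.LinearCode i) (n : ℕ)
      (G : Matrix (Fin n) (Fin 2) (S.A i)),
      S.IsStandard i G → S.IsGeneratorMatrix G C → Nat.card C = S.rowCount G := by
    rintro i C n G hG ⟨rfl, -⟩
    exact hG.card_span_eq_rowCount
  refine ⟨S.existsUnique_eq_assemble, fun C hC => ⟨(S.exists_ideal_eq_assemble_iff C).2 hC,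
    S.iSupIndep_concat C, S.card_assemble C, fun i n G hG => hcard _ _ n G hG.isStandard,
    fun i n G => hcard i _ n G, fun j => ?_⟩, S.card_ideal⟩
  rw [((S.isAdmissible_iff C).1 hC).2 j]
  exact S.card_barImage (S.star_inr_inr j) _
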